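/- **Setting.** Let $l:\mathbb R^d\times\mathcal Z\to\mathbb R$ be a loss function, measurable in $z$. For each $n\ge 1$ let $Z_n^1,\dots,Z_n^n$ be i.i.d. draws from a probability distribution $\mu_n$ on $\mathcal Z$, with $E|l(\beta,Z_n^1)|<\infty$ for all $\beta$. Put $l_n(\theta,z)=l(\theta/\sqrt n,z)$ and $L_n(\theta)=\sum_{i=1}^n l_n(\theta,Z_n^i)$. The symbols $o_p,O_p$ and "with probability approaching one" refer to $n\to\infty$ under the law of $(Z_n^1,\dots,Z_n^n)$. Let $\pi:\mathbb R^d\to\mathbb R$ be convex with a minimum at $0$ (for example a Ridge penalty $\tfrac12\theta^\top A^{-1}\theta$ with $A$ positive definite, or a Lasso penalty $\|A^{-1}\theta\|_1$ with $A$ invertible), let $\Lambda\subseteq[0,\infty)$, and let $$\hat\theta_n\in\operatorname{argmin}_\theta L_n(\theta),\qquad \hat\theta_n^\lambda\in\operatorname{argmin}_\theta\,[L_n(\theta)+\lambda\pi(\theta)],\qquad g^\lambda(\theta)=\operatorname{argmin}_g\,[\tfrac12\|g\|^2+\lambda\pi(\theta+g)]\qquad(\lambda\in\Lambda),$$ where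 $\hat\theta_n$, $\hat\theta_n^\lambda$ may be arbitrary on samples for which no minimizer exists. **Assumptions.** 1. $\theta_0$ minimizes $\theta\mapsto E[l(\theta/\sqrt n,Z_n^1)]$ for every $n\ge1$, and $\Sigma=\operatorname{Var}(\nabla_\beta l(\theta_0/\sqrt n,Z_n^1))$ does not depend on $n\ge1$. 2. $\bar L(\theta)=\lim_{n\to\infty}E[L_n(\theta)-L_n(\theta_0)]$ exists for every $\theta$, $\bar L$ is differentiable near $\theta_0$, and its Hessian at $\theta_0$ exists and is the identity. 3. There are a ball around $0$ and a measurable function $m$ such that, for each $n\ge1$ and $\mu_n$-almost every $z$, $|l(\beta_1,z)-l(\beta_2,z)|\le m(z)\|\beta_1-\beta_2\|$ for all $\beta_1,\beta_2$ in the ball and $l(\cdot,z)$ is differentiable on the ball; and $\sup_n E[m(Z_n^1)^2]<\infty$. 4. $\hat\theta_n$ is bounded in probability. 5. There is $\kappa>0$ such that $L_n$ is $\kappa$-strongly convex with probability approaching one. 6. There are measurable $B_n$ with $E[B_n(Z_n^1)^2]<\infty$ for each $n\ge1$ such that, for $\mu_n$-almost every $z$, $\|\sqrt n\nabla_\theta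 l_n(\theta,z)-\sqrt n\nabla_\theta l_n(\theta',z)\|\le B_n(z)\|\theta-\theta'\|$ for all $\theta,\theta'$; and $\sup_n E\|\sqrt n\nabla_\theta l_n(\theta_0,Z_n^1)\|^4<\infty$. 7. $\frac1n\sum_{i=1}^n\|n\nabla^2_\theta l_n(\theta_0,Z_n^i)\|^2=O_p(1)$, and there are measurable $C_n$ with $\sup_n E[C_n(Z_n^1)^2]<\infty$ such that, for $\mu_n$-almost every $z$, $\|n\nabla_\theta^2l_n(\theta,z)-n\nabla_\theta^2l_n(\theta',z)\|\le C_n(z)\|\theta-\theta'\|$ for all $\theta,\theta'$. 8. For each $n\ge1$ and $\mu_n$-almost every $z$, $l(\cdot,z)$ is four times differentiable on $\mathbb R^d$; and $\sup_nE[\sup_\theta\|n^2D^4_\theta l_n(\theta,Z_n^1)\|^4]<\infty$. **Lemma (influence function approximation).** Let $X_n^i=-\nabla_\beta l(\theta_0/\sqrt n,Z_n^i)$ and $\tilde\theta_n=\theta_0+n^{-1/2}\sum_{i=1}^nX_n^i$. Then $$L_n(\theta)-L_n(\theta_0)=\tfrac12\|\theta-\tilde\theta_n\|^2-\tfrac12\|\theta_0-\tilde\theta_n\|^2+\epsilon_n(\theta),$$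 where $\epsilon_n$ is almost surely differentiable and, for every $C<\infty$, $$\sup_{\|\theta\|\le C}|\epsilon_n(\theta)|=o_p(1),\qquad \sup_{\|\theta\|\le C}\|\nabla\epsilon_n(\theta)\|=o_p(1).$$ Moreover $$\hat\theta_n=\tilde\theta_n+o_p(1),\qquad \sup_{\lambda\in\Lambda}\|\hat\theta_n^\lambda-\tilde\theta_n-g^\lambda(\tilde\theta_n)\|=o_p(1).$$ (For non-measurable suprema or estimators, probabilities are outer probabilities.) -/

import Mathlib

open MeasureTheory ProbabilityTheory Filter Topology
open scoped NNReal ENNReal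

namespace InfluenceFunction

/-! ### Stochastic order symbols, along a sequence of probability spaces -/

section Stochastic

variable {Ω : ℕ → Type*} [∀ n, MeasurableSpace (Ω n)]

/-- `X n = o_p(1)`: for every `δ > 0`, the probability of `δ ≤ X n` tends to `0`.
(For a set that is not measurable, `P n` denotes its outer probability.) -/
def IsLittleOP (P : ∀ n, Measure (Ω n)) (X : ∀ n, Ω n → ℝ≥0∞) : Prop :=
  ∀ δ : ℝ≥0∞, 0 < δ → Tendsto (fun n => P n {ω | δ ≤ X n ω}) atTop (𝓝 0)

/-- `X n = O_p(1)`: the sequence is bounded in probability. -/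
def IsBigOP (P : ∀ n, Measure (Ω n)) (X : ∀ n, Ω n → ℝ≥0∞) : Prop :=
  ∀ η : ℝ≥0∞, 0 < η → ∃ K : ℝ≥0, ∀ᶠ n in atTop, P n {ω | (K : ℝ≥0∞) < X n ω} ≤ η

/-- The event `A n` has probability approaching one. -/
def WithProbApproachingOne (P : ∀ n, Measure (Ω n)) (A : ∀ n, Set (Ω n)) : Prop :=
  Tendsto (fun n => P n (A n)ᶜ) atTop (𝓝 0)

end Stochastic

/-! ### Minimizers and fourfold differentiability -/

section General

variable {E : Type*}

/-- `x` is a minimizer of `f` over the whole space, provided that `f` has one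
(nothing is required of `x` otherwise). -/
def IsArgmin (f : E → ℝ) (x : E) : Prop :=
  (∃ y, IsMinOn f Set.univ y) → IsMinOn f Set.univ x

/-- A minimizer of `f`, if there is one (an arbitrary point otherwise). -/
noncomputable def argmin [Nonempty E] (f : E → ℝ) : E :=
  Classical.epsilon fun x => IsMinOn f Set.univ x

/-- `f` is four times differentiable (its fourth derivative need not be continuous). -/
def FourTimesDifferentiable [NormedAddCommGroup E] [NormedSpace ℝ E] (f : E → ℝ) : Prop :=
  ContDiff ℝ 3 f ∧ Differentiable ℝ (iteratedFDeriv ℝ 3 f)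

end General

/-! ### Loss functions and estimators -/

section Model

variable {d : ℕ} {𝒵 : Type*}

local notation "𝔼" => EuclideanSpace ℝ (Fin d)

/-- The loss in the local parameter, `l_n(θ, z) = l(θ / √n, z)`. -/
noncomputable def localLoss (l : 𝔼 → 𝒵 → ℝ) (n : ℕ) (θ : 𝔼) (z : 𝒵) : ℝ :=
  l ((√(n : ℝ))⁻¹ • θ) z

/-- The empirical loss `L_n(θ) = ∑ i, l_n(θ, z i)` of the sample `z`. -/
noncomputable def empLoss (l : 𝔼 → 𝒵 → ℝ) (n : ℕ) (z : Fin n → 𝒵) (θ : 𝔼) : ℝ :=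
  ∑ i, localLoss l n θ (z i)

/-- The influence function `X_n = - ∇_β l(θ₀ / √n, z)`. -/
noncomputable def influence (l : 𝔼 → 𝒵 → ℝ) (θ₀ : 𝔼) (n : ℕ) (z : 𝒵) : 𝔼 :=
  -gradient (fun β => l β z) ((√(n : ℝ))⁻¹ • θ₀)

/-- The sample mean `θ̃_n = θ₀ + n^(-1/2) ∑ i, X_n^i`. -/
noncomputable def thetaTilde (l : 𝔼 → 𝒵 → ℝ) (θ₀ : 𝔼) (n : ℕ) (z : Fin n → 𝒵) : 𝔼 :=
  θ₀ + (√(n : ℝ))⁻¹ • ∑ i, influence l θ₀ n (z i)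

/-- `g^lam(θ) = argmin_g (‖g‖² / 2 + lam * π(θ + g))`. -/
noncomputable def gShrink (pen : 𝔼 → ℝ) (lam : ℝ) (θ : 𝔼) : 𝔼 :=
  argmin fun g : 𝔼 => 1 / 2 * ‖g‖ ^ 2 + lam * pen (θ + g)

end Model

/-! ### Standing assumptions -/

section Assumptions

variable {d : ℕ} {𝒵 : Type*} [MeasurableSpace 𝒵]
  {Ω : ℕ → Type*} [∀ n, MeasurableSpace (Ω n)]

local notation "𝔼" => EuclideanSpace ℝ (Fin d)

/-- Sequence of experiments: for each `n`, the observations `Z n i`, `i < n`, are i.i.d. draws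
from `μ n`; the minimizer `θ₀` of the expected loss in the local parameter and the variance `Sig`
of the score do not depend on `n`. -/
structure Experiments (l : 𝔼 → 𝒵 → ℝ) (μ : ℕ → Measure 𝒵) (P : ∀ n, Measure (Ω n))
    (Z : ∀ n, Fin n → Ω n → 𝒵) (θ₀ : 𝔼) (Sig : Matrix (Fin d) (Fin d) ℝ) : Prop where
  measurable_loss : ∀ β, Measurable (l β)
  indep : ∀ n, iIndepFun (Z n) (P n)
  law : ∀ n i, HasLaw (Z n i) (μ n) (P n)
  integrable_loss : ∀ n : ℕ, 0 < n → ∀ β, Integrable (l β) (μ n)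
  isMinOn : ∀ n : ℕ, 0 < n → IsMinOn (fun θ => ∫ z, localLoss l n θ z ∂μ n) Set.univ θ₀
  variance_score : ∀ n : ℕ, 0 < n → ∀ j k, Sig j k =
    cov[fun z => gradient (fun β => l β z) ((√(n : ℝ))⁻¹ • θ₀) j,
      fun z => gradient (fun β => l β z) ((√(n : ℝ))⁻¹ • θ₀) k; μ n]

/-- Normalized loss function: the expected loss `E[L_n(θ) - L_n(θ₀)]` converges for every `θ`,
and the Hessian of the limit `Lbar` at `θ₀` is the identity. -/
structure NormalizedLoss (l : 𝔼 → 𝒵 → ℝ) (P : ∀ n, Measure (Ω n))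
    (Z : ∀ n, Fin n → Ω n → 𝒵) (θ₀ : 𝔼) (Lbar : 𝔼 → ℝ) : Prop where
  tendsto : ∀ θ, Tendsto (fun n => ∫ ω, (empLoss l n (fun i => Z n i ω) θ -
    empLoss l n (fun i => Z n i ω) θ₀) ∂P n) atTop (𝓝 (Lbar θ))
  differentiable : ∀ᶠ θ in 𝓝 θ₀, DifferentiableAt ℝ Lbar θ
  hessian : HasFDerivAt (gradient Lbar) (ContinuousLinearMap.id ℝ 𝔼) θ₀

/-- Lipschitz loss: near `β = 0`, the loss is Lipschitz in `β`, with a constant `m(z)` whose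
second moment is bounded uniformly in `n`, and differentiable with probability one. -/
def LipschitzLoss (l : 𝔼 → 𝒵 → ℝ) (μ : ℕ → Measure 𝒵) : Prop :=
  ∃ r : ℝ, 0 < r ∧ ∃ m : 𝒵 → ℝ, Measurable m ∧
    (∀ n : ℕ, 0 < n → ∀ᵐ z ∂μ n, ∀ β₁ ∈ Metric.ball (0 : 𝔼) r, ∀ β₂ ∈ Metric.ball (0 : 𝔼) r,
      |l β₁ z - l β₂ z| ≤ m z * ‖β₁ - β₂‖) ∧
    (∃ K : ℝ≥0, ∀ n : ℕ, 0 < n → ∫⁻ z, ‖m z‖ₑ ^ 2 ∂μ n ≤ K) ∧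
    (∀ n : ℕ, 0 < n → ∀ᵐ z ∂μ n, ∀ β ∈ Metric.ball (0 : 𝔼) r, DifferentiableAt ℝ (fun b => l b z) β)

/-- Condition on the loss: with probability approaching one, the empirical loss is strongly convex,
with a modulus that does not depend on `n`. -/
def StronglyConvexLoss (l : 𝔼 → 𝒵 → ℝ) (P : ∀ n, Measure (Ω n))
    (Z : ∀ n, Fin n → Ω n → 𝒵) : Prop :=
  ∃ κ : ℝ, 0 < κ ∧ WithProbApproachingOne P fun n =>
    {ω | StrongConvexOn Set.univ κ (empLoss l n fun i => Z n i ω)}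

/-- Conditions on the scores `√n ∇_θ l_n(θ, z)`. -/
structure ScoreConditions (l : 𝔼 → 𝒵 → ℝ) (μ : ℕ → Measure 𝒵) (θ₀ : 𝔼) : Prop where
  lipschitz : ∃ B : ℕ → 𝒵 → ℝ, (∀ n, Measurable (B n)) ∧
    (∀ n : ℕ, 0 < n → ∀ᵐ z ∂μ n, ∀ θ θ' : 𝔼,
      ‖√(n : ℝ) • gradient (fun t => localLoss l n t z) θ -
        √(n : ℝ) • gradient (fun t => localLoss l n t z) θ'‖ ≤ B n z * ‖θ - θ'‖) ∧
    (∀ n : ℕ, 0 < n → ∫⁻ z, ‖B n z‖ₑ ^ 2 ∂μ n < ⊤)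
  moment : ∃ M : ℝ≥0, ∀ n : ℕ, 0 < n →
    ∫⁻ z, ‖√(n : ℝ) • gradient (fun t => localLoss l n t z) θ₀‖ₑ ^ 4 ∂μ n ≤ M

/-- Conditions on the Hessians `n ∇_θ² l_n(θ, z)`. -/
structure HessianConditions (l : 𝔼 → 𝒵 → ℝ) (μ : ℕ → Measure 𝒵) (P : ∀ n, Measure (Ω n))
    (Z : ∀ n, Fin n → Ω n → 𝒵) (θ₀ : 𝔼) : Prop where
  bounded : IsBigOP P fun n ω => ENNReal.ofReal ((n : ℝ)⁻¹ *
    ∑ i, ‖(n : ℝ) • iteratedFDeriv ℝ 2 (fun t => localLoss l n t (Z n i ω)) θ₀‖ ^ 2)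
  lipschitz : ∃ C : ℕ → 𝒵 → ℝ, (∀ n, Measurable (C n)) ∧
    (∀ n : ℕ, 0 < n → ∀ᵐ z ∂μ n, ∀ θ θ' : 𝔼,
      ‖(n : ℝ) • iteratedFDeriv ℝ 2 (fun t => localLoss l n t z) θ -
        (n : ℝ) • iteratedFDeriv ℝ 2 (fun t => localLoss l n t z) θ'‖ ≤ C n z * ‖θ - θ'‖) ∧
    (∃ K : ℝ≥0, ∀ n : ℕ, 0 < n → ∫⁻ z, ‖C n z‖ₑ ^ 2 ∂μ n ≤ K)

/-- Conditions on the fourth derivatives `n² D_θ⁴ l_n(θ, z)`. -/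
structure FourthDerivativeConditions (l : 𝔼 → 𝒵 → ℝ) (μ : ℕ → Measure 𝒵) : Prop where
  differentiable : ∀ n : ℕ, 0 < n → ∀ᵐ z ∂μ n, FourTimesDifferentiable fun β => l β z
  moment : ∃ M : ℝ≥0, ∀ n : ℕ, 0 < n →
    ∫⁻ z, (⨆ θ : 𝔼, ‖(n : ℝ) ^ 2 • iteratedFDeriv ℝ 4 (fun t => localLoss l n t z) θ‖ₑ) ^ 4 ∂μ n
      ≤ M

end Assumptions

end InfluenceFunction

open InfluenceFunction

/-!
# Influence function approximation of penalized estimators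

Everything is read off from Taylor expansions of the loss in the parameter `β = θ / √n`, which
runs through a shrinking neighbourhood of `0` when `θ` runs through a bounded set.

**Envelope.** Near `β = 0` the loss is `m(z)`-Lipschitz, and its fourth derivative is bounded by
some `S(z)`. Interpolation between these two bounds (`taylorControl_of_lipschitz`) controls the
first three derivatives near `0` by a multiple of `m + S`, whose second moment is bounded
uniformly in `n` (`exists_taylorControl`). The supremum that defines `S` need not be measurable,
so it is replaced by the Lipschitz constant of the third derivative, computed on a countable dense
set.

**The limit is quadratic.** The score at `θ₀ / √n` has mean zero because `θ₀` minimizes the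
expected loss. Hence `E[L_n(θ₀ + h) - L_n(θ₀)]` is half the expected Hessian at `(h, h)`, up to a
cubic remainder of order `n ^ (-1/2)`. The limit `Lbar (θ₀ + h)` is therefore homogeneous of
degree two in `h`, and its Hessian at `θ₀` being the identity forces `Lbar (θ₀ + h) = ‖h‖ ^ 2 / 2`
(`Lbar_eq_half_norm_sq`). So the expected Hessian tends to the identity
(`tendsto_integral_hessianForm`), and by the weak law of large numbers so does the average Hessian
of the sample (`isLittleOP_hessianGap`).

**Remainder.** Since `thetaTilde` absorbs the scores, the derivative of the remainder `ε_n` at `θ`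
is the average Hessian minus the identity, applied to `θ - θ₀`, plus a Taylor remainder of order
`n ^ (-1/2)` (`norm_gradient_lossRemainder_le`). Both vanish uniformly on bounded sets, and so
does `ε_n` itself, because `ε_n(θ₀) = 0`.

**Estimators.** The point `p = thetaTilde + g^λ(thetaTilde)` minimizes the quadratic plus penalty,
which grows at least like `‖θ - p‖ ^ 2 / 2` away from `p`. If `ε_n` is small on a large ball, then
the penalized loss is larger on a small sphere around `p` than at `p`; by convexity it has a
minimizer, and all its minimizers lie inside that sphere (`norm_sub_sub_le_of_isArgmin`). The
penalty enters only through its convexity and its minimum at `0`, which makes the bound uniform in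
`λ`, and the unpenalized estimator is the case of the zero penalty.
-/

set_option maxSynthPendingDepth 3

/-! ### Derivative bounds by interpolation -/

section Interpolation

variable {E F : Type*} [NormedAddCommGroup E] [NormedSpace ℝ E]
  [NormedAddCommGroup F] [NormedSpace ℝ F]

theorem norm_add_sub_sub_le_of_lipschitz_fderiv {p : E → F} (hp : Differentiable ℝ p) {S : ℝ}
    (hS : 0 ≤ S) (hlip : ∀ a b, ‖fderiv ℝ p a - fderiv ℝ p b‖ ≤ S * ‖a - b‖) (x w : E) :
    ‖p (x + w) - p x - fderiv ℝ p x w‖ ≤ S * ‖w‖ ^ 2 := by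
  have hd : ∀ y ∈ Metric.closedBall (0 : E) ‖w‖,
      HasFDerivWithinAt (fun y => p (x + y) - fderiv ℝ p x y)
        (fderiv ℝ p (x + y) - fderiv ℝ p x) (Metric.closedBall (0 : E) ‖w‖) y := by
    intro y _
    refine HasFDerivAt.hasFDerivWithinAt ?_
    exact ((hasFDerivAt_comp_add_left x).2 (hp (x + y)).hasFDerivAt).sub
      (fderiv ℝ p x).hasFDerivAt
  have hb : ∀ y ∈ Metric.closedBall (0 : E) ‖w‖,
      ‖fderiv ℝ p (x + y) - fderiv ℝ p x‖ ≤ S * ‖w‖ := by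
    intro y hy
    refine (hlip _ _).trans ?_
    rw [add_sub_cancel_left]
    exact mul_le_mul_of_nonneg_left (by simpa using hy) hS
  have := (convex_closedBall (0 : E) ‖w‖).norm_image_sub_le_of_norm_hasFDerivWithin_le hd hb
    (Metric.mem_closedBall_self (norm_nonneg w)) (by simp : w ∈ Metric.closedBall (0 : E) ‖w‖)
  simp only [add_zero, map_zero, sub_zero] at this
  calc _ = ‖p (x + w) - fderiv ℝ p x w - p x‖ := by congr 1; abel
    _ ≤ _ := this
    _ = _ := by ring

theorem norm_add_sub_two_smul_le_of_lipschitz_fderiv {p : E → F} (hp : Differentiable ℝ p) {S : ℝ}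
    (hS : 0 ≤ S) (hlip : ∀ a b, ‖fderiv ℝ p a - fderiv ℝ p b‖ ≤ S * ‖a - b‖) (x w : E) :
    ‖p (x + w) + p (x - w) - (2 : ℝ) • p x‖ ≤ 2 * S * ‖w‖ ^ 2 := by
  have h1 := norm_add_sub_sub_le_of_lipschitz_fderiv hp hS hlip x w
  have h2 := norm_add_sub_sub_le_of_lipschitz_fderiv hp hS hlip x (-w)
  rw [norm_neg, map_neg, ← sub_eq_add_neg] at h2
  calc _ = ‖(p (x + w) - p x - fderiv ℝ p x w) + (p (x - w) - p x - -fderiv ℝ p x w)‖ := by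
        congr 1; rw [two_smul]; abel
    _ ≤ _ := norm_add_le _ _
    _ ≤ _ := by linarith

/-- Error of the central difference quotient, in terms of a Lipschitz constant of the second
derivative. -/
theorem norm_central_difference_sub_le {g : E → F} (hg : Differentiable ℝ g)
    (hg' : Differentiable ℝ (fderiv ℝ g)) {S : ℝ} (hS : 0 ≤ S)
    (hlip : ∀ a b, ‖fderiv ℝ (fderiv ℝ g) a - fderiv ℝ (fderiv ℝ g) b‖ ≤ S * ‖a - b‖) (x v : E) :
    ‖g (x + v) - g (x - v) - (2 : ℝ) • fderiv ℝ g x v‖ ≤ 2 * S * ‖v‖ ^ 3 := by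
  have hd : ∀ y ∈ Metric.closedBall (0 : E) ‖v‖,
      HasFDerivWithinAt (fun y => g (x + y) - g (x - y) - (2 : ℝ) • fderiv ℝ g x y)
        (fderiv ℝ g (x + y) - -fderiv ℝ g (x - y) - (2 : ℝ) • fderiv ℝ g x)
        (Metric.closedBall (0 : E) ‖v‖) y := by
    intro y _
    refine HasFDerivAt.hasFDerivWithinAt ?_
    have h1 : HasFDerivAt (fun y => g (x - y)) (-fderiv ℝ g (x - y)) y := by
      have := (hg (x - y)).hasFDerivAt.comp y ((hasFDerivAt_id y).const_sub x)
      refine this.congr_fderiv ?_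
      ext; simp
    exact (((hasFDerivAt_comp_add_left x).2 (hg (x + y)).hasFDerivAt).sub h1).sub
      ((fderiv ℝ g x).hasFDerivAt.const_smul (2 : ℝ))
  have hb : ∀ y ∈ Metric.closedBall (0 : E) ‖v‖,
      ‖fderiv ℝ g (x + y) - -fderiv ℝ g (x - y) - (2 : ℝ) • fderiv ℝ g x‖
        ≤ 2 * S * ‖v‖ ^ 2 := by
    intro y hy
    rw [sub_neg_eq_add]
    refine (norm_add_sub_two_smul_le_of_lipschitz_fderiv hg' hS hlip x y).trans ?_
    have : ‖y‖ ≤ ‖v‖ := by simpa using hy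
    gcongr
  have := (convex_closedBall (0 : E) ‖v‖).norm_image_sub_le_of_norm_hasFDerivWithin_le hd hb
    (Metric.mem_closedBall_self (norm_nonneg v)) (by simp : v ∈ Metric.closedBall (0 : E) ‖v‖)
  simp only [add_zero, map_zero, sub_zero, sub_self, smul_zero] at this
  exact this.trans_eq (by ring)

theorem ContinuousLinearMap.opNorm_le_div_of_sphere (L : E →L[ℝ] F) {ρ C : ℝ} (hρ : 0 < ρ)
    (hC : 0 ≤ C) (h : ∀ v, ‖v‖ = ρ → ‖L v‖ ≤ C) : ‖L‖ ≤ C / ρ := by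
  refine ContinuousLinearMap.opNorm_le_of_unit_norm (by positivity) fun v hv => ?_
  have := h (ρ • v) (by rw [norm_smul, hv, mul_one, Real.norm_of_nonneg hρ.le])
  rw [map_smul, norm_smul, Real.norm_of_nonneg hρ.le] at this
  rw [le_div_iff₀ hρ]; linarith

/-- Interpolation between a bound for `g` and a Lipschitz bound for its second derivative:
the first derivative. -/
theorem norm_fderiv_le_of_bound_of_lipschitz {g : E → F} (hg : Differentiable ℝ g)
    (hg' : Differentiable ℝ (fderiv ℝ g)) {S m r : ℝ} (hS : 0 ≤ S) (hm : 0 ≤ m) (hr : 0 < r)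
    (hlip : ∀ a b, ‖fderiv ℝ (fderiv ℝ g) a - fderiv ℝ (fderiv ℝ g) b‖ ≤ S * ‖a - b‖)
    (hbound : ∀ x ∈ Metric.ball (0 : E) r, ‖g x‖ ≤ m) {x : E}
    (hx : x ∈ Metric.ball (0 : E) (r / 2)) :
    ‖fderiv ℝ g x‖ ≤ (m + S * (r / 2) ^ 3) / (r / 2) := by
  refine ContinuousLinearMap.opNorm_le_div_of_sphere _ (by positivity) (by positivity)
    fun v hv => ?_
  have hx' : ‖x‖ < r / 2 := by simpa using hx
  have h1 : ‖g (x + v)‖ ≤ m := hbound _ (by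
    rw [mem_ball_zero_iff]; exact (norm_add_le _ _).trans_lt (by linarith))
  have h2 : ‖g (x - v)‖ ≤ m := hbound _ (by
    rw [mem_ball_zero_iff]; exact (norm_sub_le _ _).trans_lt (by linarith))
  have h3 := norm_central_difference_sub_le hg hg' hS hlip x v
  rw [hv] at h3
  have h4 : ‖(2 : ℝ) • fderiv ℝ g x v‖ ≤ m + m + 2 * S * (r / 2) ^ 3 := by
    calc _ = ‖g (x + v) - g (x - v) - (g (x + v) - g (x - v) - (2 : ℝ) • fderiv ℝ g x v)‖ := by
          congr 1; abel
      _ ≤ ‖g (x + v)‖ + ‖g (x - v)‖ + _ :=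
          (norm_sub_le _ _).trans (add_le_add_left (norm_sub_le _ _) _)
      _ ≤ _ := by linarith
  rw [norm_smul, Real.norm_of_nonneg (by norm_num)] at h4
  linarith

/-- Interpolation between a bound for `g` and a Lipschitz bound for its second derivative:
the second derivative. -/
theorem norm_fderiv_fderiv_le_of_bound_of_lipschitz {g : E → F}
    (hg' : Differentiable ℝ (fderiv ℝ g)) {S m r : ℝ} (hS : 0 ≤ S) (hm : 0 ≤ m) (hr : 0 < r)
    (hlip : ∀ a b, ‖fderiv ℝ (fderiv ℝ g) a - fderiv ℝ (fderiv ℝ g) b‖ ≤ S * ‖a - b‖)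
    (hbound : ∀ x ∈ Metric.ball (0 : E) r, ‖fderiv ℝ g x‖ ≤ m) {x : E}
    (hx : x ∈ Metric.ball (0 : E) (r / 2)) :
    ‖fderiv ℝ (fderiv ℝ g) x‖ ≤ (2 * m + S * (r / 2) ^ 2) / (r / 2) := by
  refine ContinuousLinearMap.opNorm_le_div_of_sphere _ (by positivity) (by positivity)
    fun v hv => ?_
  have hx' : ‖x‖ < r / 2 := by simpa using hx
  have h1 : ‖fderiv ℝ g (x + v)‖ ≤ m := hbound _ (by
    rw [mem_ball_zero_iff]; exact (norm_add_le _ _).trans_lt (by linarith))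
  have h2 : ‖fderiv ℝ g x‖ ≤ m := hbound _ (by
    rw [mem_ball_zero_iff]; linarith)
  have h3 := norm_add_sub_sub_le_of_lipschitz_fderiv hg' hS hlip x v
  rw [hv] at h3
  calc ‖fderiv ℝ (fderiv ℝ g) x v‖
      = ‖fderiv ℝ g (x + v) - fderiv ℝ g x
          - (fderiv ℝ g (x + v) - fderiv ℝ g x - fderiv ℝ (fderiv ℝ g) x v)‖ := by
        congr 1; abel
    _ ≤ ‖fderiv ℝ g (x + v)‖ + ‖fderiv ℝ g x‖ + _ :=
        (norm_sub_le _ _).trans (add_le_add_left (norm_sub_le _ _) _)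
    _ ≤ _ := by linarith

/-- `f` is twice differentiable, and on the ball of radius `ρ` around `0` the number `G` bounds its
first two derivatives and is a Lipschitz constant of the second one. -/
structure TaylorControl (f : E → ℝ) (ρ G : ℝ) : Prop where
  differentiable : Differentiable ℝ f
  differentiable_fderiv : Differentiable ℝ (fderiv ℝ f)
  norm_fderiv_le : ∀ x ∈ Metric.ball (0 : E) ρ, ‖fderiv ℝ f x‖ ≤ G
  norm_hessian_le : ∀ x ∈ Metric.ball (0 : E) ρ, ‖fderiv ℝ (fderiv ℝ f) x‖ ≤ G
  hessian_lipschitz : ∀ x ∈ Metric.ball (0 : E) ρ, ∀ y ∈ Metric.ball (0 : E) ρ,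
    ‖fderiv ℝ (fderiv ℝ f) y - fderiv ℝ (fderiv ℝ f) x‖ ≤ G * ‖y - x‖

/-- The constant in the interpolation inequality. -/
noncomputable def interpolationConst (r : ℝ) : ℝ :=
  (1 + (1 + (r / 2) ^ 3) / (r / 2)) +
    (2 * ((1 + (r / 2) ^ 3) / (r / 2)) + (r / 2 / 2) ^ 2) / (r / 2 / 2)

/-- A function that is `m`-Lipschitz near `0`, with a globally `S`-Lipschitz third derivative, has
its first three derivatives near `0` bounded by a multiple of `m + S`. -/
theorem taylorControl_of_lipschitz {f : E → ℝ} (h0 : Differentiable ℝ f)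
    (h1 : Differentiable ℝ (fderiv ℝ f)) (h2 : Differentiable ℝ (fderiv ℝ (fderiv ℝ f)))
    {S m r : ℝ} (hS : 0 ≤ S) (hm : 0 ≤ m) (hr : 0 < r)
    (hlip : ∀ a b, ‖fderiv ℝ (fderiv ℝ (fderiv ℝ f)) a - fderiv ℝ (fderiv ℝ (fderiv ℝ f)) b‖
      ≤ S * ‖a - b‖)
    (hf : ∀ x ∈ Metric.ball (0 : E) r, ∀ y ∈ Metric.ball (0 : E) r, |f x - f y| ≤ m * ‖x - y‖) :
    TaylorControl f (r / 4) (interpolationConst r * (m + S)) := by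
  have b1 : ∀ x ∈ Metric.ball (0 : E) r, ‖fderiv ℝ f x‖ ≤ m := fun x hx =>
    norm_fderiv_le_of_lip' ℝ hm (by
      filter_upwards [Metric.isOpen_ball.mem_nhds hx] with y hy using hf y hy x hx)
  have b2 : ∀ x ∈ Metric.ball (0 : E) (r / 2), ‖fderiv ℝ (fderiv ℝ f) x‖ ≤
      (m + S * (r / 2) ^ 3) / (r / 2) := fun x hx =>
    norm_fderiv_le_of_bound_of_lipschitz h1 h2 hS hm hr hlip b1 hx
  have b3 : ∀ x ∈ Metric.ball (0 : E) (r / 2 / 2), ‖fderiv ℝ (fderiv ℝ (fderiv ℝ f)) x‖ ≤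
      (2 * ((m + S * (r / 2) ^ 3) / (r / 2)) + S * (r / 2 / 2) ^ 2) / (r / 2 / 2) := fun x hx =>
    norm_fderiv_fderiv_le_of_bound_of_lipschitz h2 hS (by positivity) (by positivity) hlip b2 hx
  have e4 : r / 2 / 2 = r / 4 := by ring
  have hA : (m + S * (r / 2) ^ 3) / (r / 2) ≤ (1 + (r / 2) ^ 3) / (r / 2) * (m + S) := by
    rw [div_mul_eq_mul_div]
    gcongr
    nlinarith [mul_nonneg hm (by positivity : 0 ≤ (r / 2) ^ 3)]
  have hA0 : 0 ≤ (1 + (r / 2) ^ 3) / (r / 2) * (m + S) := by positivity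
  have hB : (2 * ((m + S * (r / 2) ^ 3) / (r / 2)) + S * (r / 2 / 2) ^ 2) / (r / 2 / 2) ≤
      (2 * ((1 + (r / 2) ^ 3) / (r / 2)) + (r / 2 / 2) ^ 2) / (r / 2 / 2) * (m + S) := by
    rw [div_mul_eq_mul_div]
    gcongr
    nlinarith [mul_nonneg hm (by positivity : 0 ≤ (r / 2 / 2) ^ 2)]
  have hB0 : 0 ≤ (2 * ((1 + (r / 2) ^ 3) / (r / 2)) + (r / 2 / 2) ^ 2) / (r / 2 / 2) * (m + S) := by
    positivity
  have hG : interpolationConst r * (m + S) = (m + S) + (1 + (r / 2) ^ 3) / (r / 2) * (m + S) +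
      (2 * ((1 + (r / 2) ^ 3) / (r / 2)) + (r / 2 / 2) ^ 2) / (r / 2 / 2) * (m + S) := by
    rw [interpolationConst]; ring
  refine ⟨h0, h1, fun x hx => ?_, fun x hx => ?_, fun x hx y hy => ?_⟩
  · have := b1 x (Metric.ball_subset_ball (by linarith) hx)
    linarith
  · have := b2 x (Metric.ball_subset_ball (by linarith) hx)
    linarith
  · refine (convex_ball (0 : E) (r / 4)).norm_image_sub_le_of_norm_fderiv_le (𝕜 := ℝ)
      (fun x _ => h2 x) (fun z hz => ?_) hx hy
    have := b3 z (e4 ▸ hz)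
    linarith

variable {f : E → ℝ} {ρ G : ℝ} {x y : E}

theorem TaylorControl.norm_fderiv_sub_le (h : TaylorControl f ρ G)
    (hx : x ∈ Metric.ball (0 : E) ρ) (hy : y ∈ Metric.ball (0 : E) ρ) :
    ‖fderiv ℝ f y - fderiv ℝ f x - fderiv ℝ (fderiv ℝ f) x (y - x)‖ ≤ G * ‖y - x‖ ^ 2 := by
  have hG : 0 ≤ G := (norm_nonneg _).trans (h.norm_fderiv_le x hx)
  set s := Metric.ball (0 : E) ρ ∩ Metric.closedBall x ‖y - x‖
  have hs : Convex ℝ s := (convex_ball _ _).inter (convex_closedBall _ _)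
  have := hs.norm_image_sub_le_of_norm_hasFDerivWithin_le' (𝕜 := ℝ) (f := fderiv ℝ f)
    (f' := fderiv ℝ (fderiv ℝ f)) (φ := fderiv ℝ (fderiv ℝ f) x) (C := G * ‖y - x‖)
    (fun z _ => (h.differentiable_fderiv z).hasFDerivAt.hasFDerivWithinAt)
    (fun z hz => (h.hessian_lipschitz x hx z hz.1).trans
      (mul_le_mul_of_nonneg_left (by simpa [dist_eq_norm] using hz.2) hG))
    ⟨hx, by simp⟩ (⟨hy, by simp [dist_eq_norm]⟩ : y ∈ s)
  exact this.trans_eq (by ring)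

theorem TaylorControl.abs_sub_le (h : TaylorControl f ρ G)
    (hx : x ∈ Metric.ball (0 : E) ρ) (hy : y ∈ Metric.ball (0 : E) ρ) :
    |f y - f x - fderiv ℝ f x (y - x) - 1 / 2 * fderiv ℝ (fderiv ℝ f) x (y - x) (y - x)|
      ≤ G * ‖y - x‖ ^ 3 := by
  have hG : 0 ≤ G := (norm_nonneg _).trans (h.norm_fderiv_le x hx)
  set H := fderiv ℝ (fderiv ℝ f) x with hH
  have hsymm : ∀ v w, H v w = H w v := fun v w =>
    second_derivative_symmetric (f := f) (f' := fderiv ℝ f)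
      (fun z => (h.differentiable z).hasFDerivAt) (h.differentiable_fderiv x).hasFDerivAt v w
  set s := Metric.ball (0 : E) ρ ∩ Metric.closedBall x ‖y - x‖
  have hs : Convex ℝ s := (convex_ball _ _).inter (convex_closedBall _ _)
  have hd : ∀ z ∈ s, HasFDerivWithinAt
      (fun z => f z - fderiv ℝ f x (z - x) - 1 / 2 * H (z - x) (z - x))
      (fderiv ℝ f z - fderiv ℝ f x - H (z - x)) s z := by
    intro z _
    refine HasFDerivAt.hasFDerivWithinAt ?_
    have e1 : HasFDerivAt (fun z : E => z - x) (ContinuousLinearMap.id ℝ E) z :=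
      (hasFDerivAt_id z).sub_const x
    have e2 : HasFDerivAt (fun z => fderiv ℝ f x (z - x)) (fderiv ℝ f x) z := by
      exact (fderiv ℝ f x).hasFDerivAt.comp z e1
    have e3 := ((H.hasFDerivAt.comp z e1).clm_apply e1).const_mul (1 / 2 : ℝ)
    refine (((h.differentiable z).hasFDerivAt.sub e2).sub e3).congr_fderiv ?_
    ext v
    have := hsymm v (z - x)
    simp only [_root_.sub_apply, _root_.smul_apply,
      _root_.add_apply, ContinuousLinearMap.comp_apply, ContinuousLinearMap.flip_apply,
      ContinuousLinearMap.id_apply, Function.comp_apply, smul_eq_mul, this]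
    ring
  have := hs.norm_image_sub_le_of_norm_hasFDerivWithin_le (C := G * ‖y - x‖ ^ 2) hd
    (fun z hz => (h.norm_fderiv_sub_le hx hz.1).trans
      (by
        have : ‖z - x‖ ≤ ‖y - x‖ := by simpa [dist_eq_norm] using hz.2
        gcongr))
    ⟨hx, by simp⟩ (⟨hy, by simp [dist_eq_norm]⟩ : y ∈ s)
  simp only [sub_self, map_zero, mul_zero, sub_zero, Real.norm_eq_abs] at this
  calc _ = |f y - fderiv ℝ f x (y - x) - 1 / 2 * H (y - x) (y - x) - f x| := by
        congr 1; ring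
    _ ≤ _ := this
    _ = _ := by ring

theorem TaylorControl.hessian_symm (h : TaylorControl f ρ G) (x v w : E) :
    fderiv ℝ (fderiv ℝ f) x v w = fderiv ℝ (fderiv ℝ f) x w v :=
  second_derivative_symmetric (f := f) (f' := fderiv ℝ f)
    (fun z => (h.differentiable z).hasFDerivAt) (h.differentiable_fderiv x).hasFDerivAt v w

end Interpolation

/-! ### Measurable moduli of the derivatives -/

section Measurability

variable {E F 𝒵 : Type*} [NormedAddCommGroup E] [NormedSpace ℝ E]
  [NormedAddCommGroup F] [NormedSpace ℝ F] [MeasurableSpace 𝒵] {μ : Measure 𝒵}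

/-- Measurability in `z` of the derivative in a parameter, from measurability of each `f a`:
directional derivatives are limits of difference quotients, and finitely many of them
determine the derivative. -/
theorem aestronglyMeasurable_fderiv_of_param [FiniteDimensional ℝ E] {f : E → 𝒵 → F}
    (hf : ∀ a, AEStronglyMeasurable (f a) μ)
    (hd : ∀ᵐ z ∂μ, Differentiable ℝ fun a => f a z) (a : E) :
    AEStronglyMeasurable (fun z => fderiv ℝ (fun a => f a z) a) μ := by
  have happly : ∀ v : E, AEStronglyMeasurable (fun z => fderiv ℝ (fun a => f a z) a v) μ := by
    intro v
    refine aestronglyMeasurable_of_tendsto_ae (u := atTop)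
      (f := fun (k : ℕ) z => (k : ℝ) • (f (a + (k : ℝ)⁻¹ • v) z - f a z))
      (fun k => ((hf _).sub (hf _)).const_smul _) ?_
    filter_upwards [hd] with z hz
    refine (hz a).hasFDerivAt.lim v ?_
    simpa using tendsto_natCast_atTop_atTop (R := ℝ)
  let b := Module.finBasis ℝ E
  have hsum : (fun z => fderiv ℝ (fun a => f a z) a) = fun z => ∑ i,
      ContinuousLinearMap.smulRightL ℝ E F (LinearMap.toContinuousLinearMap (b.coord i))
        (fderiv ℝ (fun a => f a z) a (b i)) := by
    ext z v
    conv_lhs => rw [← b.sum_repr v, map_sum]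
    simp
  rw [hsum]
  refine Finset.aestronglyMeasurable_fun_sum _ fun i _ => ?_
  exact (ContinuousLinearMap.continuous _).comp_aestronglyMeasurable (happly _)

end Measurability

section DenseLipschitz

variable {E F 𝒵 : Type*} [NormedAddCommGroup E] [NormedAddCommGroup F]

/-- The optimal Lipschitz constant of `f · z`, as a supremum over a countable dense set. -/
noncomputable def denseLipschitzConst [TopologicalSpace.SeparableSpace E] (f : E → 𝒵 → F) (z : 𝒵) :
    ℝ≥0∞ :=
  ⨆ p : ℕ × ℕ, ‖f (TopologicalSpace.denseSeq E p.1) z - f (TopologicalSpace.denseSeq E p.2) z‖ₑ /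
    ‖TopologicalSpace.denseSeq E p.1 - TopologicalSpace.denseSeq E p.2‖ₑ

variable [TopologicalSpace.SeparableSpace E]

theorem aemeasurable_denseLipschitzConst [MeasurableSpace 𝒵] {μ : Measure 𝒵} {f : E → 𝒵 → F}
    (hf : ∀ a, AEStronglyMeasurable (f a) μ) : AEMeasurable (denseLipschitzConst f) μ :=
  AEMeasurable.iSup fun _ => ((hf _).sub (hf _)).enorm.div_const _

theorem denseLipschitzConst_le {f : E → 𝒵 → F} {z : 𝒵} {S : ℝ≥0∞}
    (h : ∀ a b, ‖f a z - f b z‖ₑ ≤ S * ‖a - b‖ₑ) : denseLipschitzConst f z ≤ S :=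
  iSup_le fun _ => ENNReal.div_le_of_le_mul (h _ _)

theorem norm_sub_le_denseLipschitzConst {f : E → 𝒵 → F} {z : 𝒵} (hc : Continuous fun a => f a z)
    (hfin : denseLipschitzConst f z ≠ ⊤) (a b : E) :
    ‖f a z - f b z‖ ≤ (denseLipschitzConst f z).toReal * ‖a - b‖ := by
  refine (TopologicalSpace.denseRange_denseSeq E).induction_on₂
    (p := fun a b => ‖f a z - f b z‖ ≤ (denseLipschitzConst f z).toReal * ‖a - b‖)
    (isClosed_le (by fun_prop) (by fun_prop)) (fun i j => ?_) a b
  by_cases hij : TopologicalSpace.denseSeq E i = TopologicalSpace.denseSeq E j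
  · simp [hij]
  have h1 : ‖f (TopologicalSpace.denseSeq E i) z - f (TopologicalSpace.denseSeq E j) z‖ₑ /
      ‖TopologicalSpace.denseSeq E i - TopologicalSpace.denseSeq E j‖ₑ ≤ denseLipschitzConst f z :=
    le_iSup (fun p : ℕ × ℕ => ‖f (TopologicalSpace.denseSeq E p.1) z -
      f (TopologicalSpace.denseSeq E p.2) z‖ₑ /
      ‖TopologicalSpace.denseSeq E p.1 - TopologicalSpace.denseSeq E p.2‖ₑ) (i, j)
  rw [ENNReal.div_le_iff (by simpa [sub_eq_zero] using hij) (by simp)] at h1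
  have h2 := ENNReal.toReal_mono (ENNReal.mul_ne_top hfin (by simp)) h1
  simpa using h2

end DenseLipschitz

section FourthDerivative

variable {E : Type*} [NormedAddCommGroup E] [NormedSpace ℝ E]
  {F : Type*} [NormedAddCommGroup F] [NormedSpace ℝ F]

theorem differentiable_iteratedFDeriv_succ_iff {f : E → F} (k : ℕ) :
    Differentiable ℝ (iteratedFDeriv ℝ (k + 1) f) ↔
      Differentiable ℝ (iteratedFDeriv ℝ k (fderiv ℝ f)) := by
  have : iteratedFDeriv ℝ (k + 1) f = (continuousMultilinearCurryRightEquiv' ℝ k E F).symm ∘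
      iteratedFDeriv ℝ k (fderiv ℝ f) := by
    ext x; rw [iteratedFDeriv_succ_eq_comp_right]
  rw [this]
  exact LinearIsometryEquiv.comp_differentiable_iff _

theorem differentiable_iteratedFDeriv_zero_iff {f : E → F} :
    Differentiable ℝ (iteratedFDeriv ℝ 0 f) ↔ Differentiable ℝ f := by
  rw [iteratedFDeriv_zero_eq_comp]
  exact LinearIsometryEquiv.comp_differentiable_iff _

variable {f : E → ℝ}

theorem InfluenceFunction.FourTimesDifferentiable.differentiable_fderiv_three
    (h : FourTimesDifferentiable f) : Differentiable ℝ (fderiv ℝ (fderiv ℝ (fderiv ℝ f))) := by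
  have := h.2
  rwa [differentiable_iteratedFDeriv_succ_iff, differentiable_iteratedFDeriv_succ_iff,
    differentiable_iteratedFDeriv_succ_iff, differentiable_iteratedFDeriv_zero_iff] at this

theorem InfluenceFunction.FourTimesDifferentiable.differentiable_fderiv_two
    (h : FourTimesDifferentiable f) : Differentiable ℝ (fderiv ℝ (fderiv ℝ f)) := by
  have := h.1.differentiable_iteratedFDeriv (m := 2) (by norm_num)
  rwa [differentiable_iteratedFDeriv_succ_iff, differentiable_iteratedFDeriv_succ_iff,
    differentiable_iteratedFDeriv_zero_iff] at this

theorem InfluenceFunction.FourTimesDifferentiable.differentiable_fderiv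
    (h : FourTimesDifferentiable f) : Differentiable ℝ (fderiv ℝ f) := by
  have := h.1.differentiable_iteratedFDeriv (m := 1) (by norm_num)
  rwa [differentiable_iteratedFDeriv_succ_iff, differentiable_iteratedFDeriv_zero_iff] at this

theorem InfluenceFunction.FourTimesDifferentiable.differentiable
    (h : FourTimesDifferentiable f) : Differentiable ℝ f :=
  h.1.differentiable (by norm_num)

theorem norm_fderiv_iterate_four_eq (f : E → ℝ) (x : E) :
    ‖fderiv ℝ (fderiv ℝ (fderiv ℝ (fderiv ℝ f))) x‖ = ‖iteratedFDeriv ℝ 4 f x‖ := by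
  rw [← norm_iteratedFDeriv_fderiv, ← norm_iteratedFDeriv_fderiv, ← norm_iteratedFDeriv_fderiv,
    ← norm_iteratedFDeriv_fderiv, norm_iteratedFDeriv_zero]

theorem norm_iteratedFDeriv_four_comp_smul (h : FourTimesDifferentiable f) (c : ℝ) (x : E) :
    ‖iteratedFDeriv ℝ 4 (fun y => f (c • y)) x‖ = |c| ^ 4 * ‖iteratedFDeriv ℝ 4 f (c • x)‖ := by
  have h3 := iteratedFDeriv_comp_const_smul (𝕜 := ℝ) (i := 3) c h.1
  rw [← norm_fderiv_iteratedFDeriv, ← norm_fderiv_iteratedFDeriv, h3]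
  have hd : DifferentiableAt ℝ (fun y => iteratedFDeriv ℝ 3 f (c • y)) x :=
    (h.2 (c • x)).comp x (by fun_prop)
  rw [fderiv_fun_const_smul hd, fderiv_comp_smul, smul_smul,
    norm_smul, Real.norm_eq_abs, ← pow_succ, abs_pow]

end FourthDerivative

section Modulus

variable {d : ℕ} {𝒵 : Type*}

/-- The third derivative in `β` is Lipschitz, with the scaled fourth derivative in the local
parameter as a Lipschitz constant. -/
theorem enorm_fderiv_three_sub_le {l : EuclideanSpace ℝ (Fin d) → 𝒵 → ℝ} {n : ℕ} (hn : 0 < n)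
    {z : 𝒵} (h : FourTimesDifferentiable fun β => l β z) {S : ℝ≥0∞}
    (hS : ∀ θ, ‖(n : ℝ) ^ 2 • iteratedFDeriv ℝ 4 (fun t => localLoss l n t z) θ‖ₑ ≤ S)
    (a b : EuclideanSpace ℝ (Fin d)) :
    ‖fderiv ℝ (fderiv ℝ (fderiv ℝ fun β => l β z)) a -
      fderiv ℝ (fderiv ℝ (fderiv ℝ fun β => l β z)) b‖ₑ ≤ S * ‖a - b‖ₑ := by
  by_cases hab : a = b
  · rw [hab, sub_self, sub_self, ← ofReal_norm, norm_zero, ENNReal.ofReal_zero]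
    exact zero_le
  by_cases htop : S = ⊤
  · rw [htop, ENNReal.top_mul (by simpa [sub_eq_zero] using hab)]
    exact le_top
  lift S to ℝ≥0 using htop
  have hn' : (0 : ℝ) < n := by exact_mod_cast hn
  -- the factor `n ^ 2` cancels the scaling by `√n` of the fourth derivative
  have hbound : ∀ x ∈ (Set.univ : Set (EuclideanSpace ℝ (Fin d))),
      ‖fderiv ℝ (fderiv ℝ (fderiv ℝ (fderiv ℝ fun β => l β z))) x‖ ≤ S := by
    intro x _
    have h1 := hS (√(n : ℝ) • x)
    rw [enorm_le_coe, ← NNReal.coe_le_coe, coe_nnnorm, norm_smul] at h1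
    simp only [localLoss] at h1
    rw [norm_iteratedFDeriv_four_comp_smul h, smul_smul,
      inv_mul_cancel₀ (by positivity), one_smul, ← norm_fderiv_iterate_four_eq] at h1
    have h2 : ‖(n : ℝ) ^ 2‖ * |(√(n : ℝ))⁻¹| ^ 4 = 1 := by
      rw [Real.norm_of_nonneg (by positivity), abs_of_nonneg (by positivity), inv_pow,
        show (4 : ℕ) = 2 * 2 from rfl, pow_mul, Real.sq_sqrt hn'.le, mul_inv_cancel₀]
      positivity
    rwa [← mul_assoc, h2, one_mul] at h1
  have := convex_univ.norm_image_sub_le_of_norm_fderiv_le (𝕜 := ℝ)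
    (fun x _ => h.differentiable_fderiv_three x) hbound (Set.mem_univ b) (Set.mem_univ a)
  rw [← enorm_norm (a - b), ← enorm_norm (_ - _), Real.enorm_of_nonneg (norm_nonneg _),
    Real.enorm_of_nonneg (norm_nonneg _), ← ENNReal.ofReal_coe_nnreal,
    ← ENNReal.ofReal_mul S.coe_nonneg]
  exact ENNReal.ofReal_le_ofReal this

/-- Uniformly in `n`, the first three derivatives of the loss near `β = 0` have an envelope with
bounded second moments. -/
theorem exists_taylorControl [MeasurableSpace 𝒵] {l : EuclideanSpace ℝ (Fin d) → 𝒵 → ℝ}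
    {μ : ℕ → Measure 𝒵}
    [∀ n, IsProbabilityMeasure (μ n)] (hmeas : ∀ β, Measurable (l β))
    (hlip : LipschitzLoss l μ) (hfourth : FourthDerivativeConditions l μ) :
    ∃ ρ : ℝ, 0 < ρ ∧ ∃ K : ℝ≥0, ∀ n : ℕ, 0 < n → ∃ G : 𝒵 → ℝ, AEMeasurable G (μ n) ∧
      ∫⁻ z, ‖G z‖ₑ ^ 2 ∂μ n ≤ K ∧ ∀ᵐ z ∂μ n, TaylorControl (fun β => l β z) ρ (G z) := by
  obtain ⟨r, hr, m, hm, hml, ⟨K, hK⟩, -⟩ := hlip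
  obtain ⟨M, hM⟩ := hfourth.moment
  set c := interpolationConst r with hc
  refine ⟨r / 4, by positivity, (2 * c ^ 2).toNNReal * (K + 1 + M), fun n hn => ?_⟩
  have hdiff := hfourth.differentiable n hn
  have m1 : ∀ a, AEStronglyMeasurable (fun z => fderiv ℝ (fun β => l β z) a) (μ n) :=
    aestronglyMeasurable_fderiv_of_param (fun a => (hmeas a).aestronglyMeasurable)
      (hdiff.mono fun z h => h.differentiable)
  have m2 : ∀ a, AEStronglyMeasurable (fun z => fderiv ℝ (fderiv ℝ fun β => l β z) a) (μ n) :=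
    aestronglyMeasurable_fderiv_of_param m1 (hdiff.mono fun z h => h.differentiable_fderiv)
  have m3 : ∀ a, AEStronglyMeasurable
      (fun z => fderiv ℝ (fderiv ℝ (fderiv ℝ fun β => l β z)) a) (μ n) :=
    aestronglyMeasurable_fderiv_of_param m2 (hdiff.mono fun z h => h.differentiable_fderiv_two)
  set T : 𝒵 → ℝ≥0∞ :=
    denseLipschitzConst fun a z => fderiv ℝ (fderiv ℝ (fderiv ℝ fun β => l β z)) a with hT
  have hTm : AEMeasurable T (μ n) := aemeasurable_denseLipschitzConst m3
  -- the supremum in the moment condition need not be measurable, so that its integral is a lower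
  -- integral; it still dominates the integral of the measurable function `T ^ 4`
  have hTM : ∫⁻ z, T z ^ 4 ∂μ n ≤ M := by
    refine (lintegral_mono_ae ?_).trans (hM n hn)
    filter_upwards [hdiff] with z hz
    refine pow_le_pow_left' ?_ 4
    exact denseLipschitzConst_le fun a b => enorm_fderiv_three_sub_le hn hz
      (fun θ => le_iSup (fun θ => ‖(n : ℝ) ^ 2 •
        iteratedFDeriv ℝ 4 (fun t => localLoss l n t z) θ‖ₑ) θ) a b
  have hTfin : ∀ᵐ z ∂μ n, T z ≠ ⊤ := by
    filter_upwards [ae_lt_top' (hTm.pow_const 4) (hTM.trans_lt ENNReal.coe_lt_top).ne]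
      with z hz htop
    simp [htop] at hz
  refine ⟨fun z => c * (|m z| + (T z).toReal), ?_, ?_, ?_⟩
  · exact ((hm.abs.aemeasurable).add hTm.ennreal_toReal).const_mul c
  · have hpt : ∀ᵐ z ∂μ n, ‖c * (|m z| + (T z).toReal)‖ₑ ^ 2 ≤
        (2 * c ^ 2).toNNReal * (‖m z‖ₑ ^ 2 + 1 + T z ^ 4) := by
      filter_upwards [hTfin] with z hz
      rw [← ENNReal.ofReal_toReal hz, Real.enorm_eq_ofReal_abs, Real.enorm_eq_ofReal_abs,
        ← ENNReal.ofReal_pow (abs_nonneg _), ← ENNReal.ofReal_pow (abs_nonneg _),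
        ← ENNReal.ofReal_pow ENNReal.toReal_nonneg, ← ENNReal.ofReal_one,
        ← ENNReal.ofReal_add (by positivity) (by positivity),
        ← ENNReal.ofReal_add (by positivity) (by positivity), ← ENNReal.ofReal,
        ← ENNReal.ofReal_mul (by positivity)]
      refine ENNReal.ofReal_le_ofReal ?_
      rw [sq_abs, mul_pow, ENNReal.toReal_ofReal ENNReal.toReal_nonneg]
      set t := (T z).toReal
      have h1 : (|m z| + t) ^ 2 ≤ 2 * (|m z| ^ 2 + 1 + t ^ 4) := by
        nlinarith [sq_nonneg (|m z| - t), sq_nonneg (t ^ 2 - 1)]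
      nlinarith [mul_le_mul_of_nonneg_left h1 (sq_nonneg c)]
    calc _ ≤ ∫⁻ z, (2 * c ^ 2).toNNReal * (‖m z‖ₑ ^ 2 + 1 + T z ^ 4) ∂μ n := lintegral_mono_ae hpt
      _ = (2 * c ^ 2).toNNReal * (∫⁻ z, ‖m z‖ₑ ^ 2 ∂μ n + 1 + ∫⁻ z, T z ^ 4 ∂μ n) := by
        rw [lintegral_const_mul' _ _ ENNReal.coe_ne_top, lintegral_add_right' _ (hTm.pow_const 4),
          lintegral_add_right _ measurable_const, lintegral_const, measure_univ, mul_one]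
      _ ≤ (2 * c ^ 2).toNNReal * (K + 1 + M) := by gcongr; exact hK n hn
      _ = _ := by push_cast; rfl
  · filter_upwards [hTfin, hdiff, hml n hn] with z hz hzd hzl
    refine taylorControl_of_lipschitz hzd.differentiable hzd.differentiable_fderiv
      hzd.differentiable_fderiv_two ENNReal.toReal_nonneg (abs_nonneg _) hr ?_ ?_
    · exact norm_sub_le_denseLipschitzConst (f := fun a z =>
        fderiv ℝ (fderiv ℝ (fderiv ℝ fun β => l β z)) a)
        hzd.differentiable_fderiv_three.continuous hz
    · intro x hx y hy
      exact (hzl x hx y hy).trans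
        (mul_le_mul_of_nonneg_right (le_abs_self _) (norm_nonneg _))

end Modulus

/-! ### Calculus of the stochastic order symbols -/

section StochasticOrder

variable {Ω : ℕ → Type*} [∀ n, MeasurableSpace (Ω n)] {P : ∀ n, Measure (Ω n)}
  {X Y : ∀ n, Ω n → ℝ≥0∞}

theorem InfluenceFunction.IsLittleOP.mono (hY : IsLittleOP P Y)
    (h : ∀ᶠ n in atTop, ∀ᵐ ω ∂P n, X n ω ≤ Y n ω) : IsLittleOP P X := by
  intro δ hδ
  refine tendsto_of_tendsto_of_tendsto_of_le_of_le' tendsto_const_nhds (hY δ hδ)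
    (Eventually.of_forall fun _ => zero_le) ?_
  filter_upwards [h] with n hn
  refine measure_mono_ae ?_
  filter_upwards [hn] with ω hω h'
  exact le_trans h' hω

theorem InfluenceFunction.IsLittleOP.add (hX : IsLittleOP P X) (hY : IsLittleOP P Y) :
    IsLittleOP P fun n ω => X n ω + Y n ω := by
  intro δ hδ
  have h := (hX (δ / 2) (ENNReal.half_pos hδ.ne')).add (hY (δ / 2) (ENNReal.half_pos hδ.ne'))
  rw [add_zero] at h
  refine tendsto_of_tendsto_of_tendsto_of_le_of_le tendsto_const_nhds h (fun _ => zero_le)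
    fun n => ?_
  refine (measure_mono ?_).trans (measure_union_le _ _)
  intro ω hω
  by_contra hcon
  simp only [Set.mem_union, Set.mem_ofPred_eq, not_or, not_le] at hcon hω
  have h2 := ENNReal.add_lt_add hcon.1 hcon.2
  rw [ENNReal.add_halves] at h2
  exact absurd hω (not_le.2 h2)

theorem InfluenceFunction.IsLittleOP.zero : IsLittleOP P fun _ _ => 0 := by
  intro δ hδ
  simp [hδ.ne']

theorem InfluenceFunction.IsLittleOP.sum {ι : Type*} (s : Finset ι) {X : ι → ∀ n, Ω n → ℝ≥0∞}
    (h : ∀ i ∈ s, IsLittleOP P (X i)) : IsLittleOP P fun n ω => ∑ i ∈ s, X i n ω := by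
  classical
  induction s using Finset.induction_on with
  | empty => simpa using IsLittleOP.zero
  | insert a s ha ih =>
    simp only [Finset.sum_insert ha]
    exact (h a (by simp)).add (ih fun i hi => h i (by simp [hi]))

theorem InfluenceFunction.IsLittleOP.const_mul (hX : IsLittleOP P X) (c : ℝ≥0) :
    IsLittleOP P fun n ω => c * X n ω := by
  intro δ hδ
  by_cases hδt : δ = ⊤
  · refine tendsto_of_tendsto_of_tendsto_of_le_of_le tendsto_const_nhds (hX 1 one_pos)
      (fun _ => zero_le) fun n => measure_mono fun ω hω => ?_
    simp only [Set.mem_ofPred_eq, hδt, top_le_iff] at hω ⊢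
    by_contra hcon
    exact ENNReal.mul_ne_top ENNReal.coe_ne_top ((not_le.1 hcon).trans ENNReal.one_lt_top).ne hω
  refine tendsto_of_tendsto_of_tendsto_of_le_of_le tendsto_const_nhds
    (hX (δ / (c + 1)) (ENNReal.div_pos hδ.ne' (by simp)))
    (fun _ => zero_le) fun n => measure_mono fun ω hω => ?_
  simp only [Set.mem_ofPred_eq] at hω ⊢
  refine ENNReal.div_le_of_le_mul' (hω.trans ?_)
  gcongr
  exact le_self_add

theorem InfluenceFunction.IsLittleOP.of_lintegral (hm : ∀ᶠ n in atTop, AEMeasurable (X n) (P n))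
    (h : Tendsto (fun n => ∫⁻ ω, X n ω ∂P n) atTop (𝓝 0)) : IsLittleOP P X := by
  intro δ hδ
  by_cases hδt : δ = ⊤
  · refine tendsto_of_tendsto_of_tendsto_of_le_of_le' tendsto_const_nhds h
      (Eventually.of_forall fun _ => zero_le) ?_
    filter_upwards [hm] with n hn
    have := mul_meas_ge_le_lintegral₀ hn 1
    rw [one_mul] at this
    exact (measure_mono fun ω (hω : δ ≤ X n ω) => show 1 ≤ X n ω from
      (by rw [hδt]; exact le_top : (1 : ℝ≥0∞) ≤ δ).trans hω).trans this
  have h2 : Tendsto (fun n => (∫⁻ ω, X n ω ∂P n) / δ) atTop (𝓝 0) := by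
    simpa using ENNReal.Tendsto.div_const h (Or.inr hδ.ne')
  refine tendsto_of_tendsto_of_tendsto_of_le_of_le' tendsto_const_nhds h2
    (Eventually.of_forall fun _ => zero_le) ?_
  filter_upwards [hm] with n hn
  exact meas_ge_le_lintegral_div hn hδ.ne' hδt

theorem InfluenceFunction.IsBigOP.mono (hY : IsBigOP P Y)
    (h : ∀ᶠ n in atTop, ∀ᵐ ω ∂P n, X n ω ≤ Y n ω) : IsBigOP P X := by
  intro η hη
  obtain ⟨K, hK⟩ := hY η hη
  refine ⟨K, ?_⟩
  filter_upwards [hK, h] with n hn hn'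
  refine (measure_mono_ae ?_).trans hn
  filter_upwards [hn'] with ω hω h'
  exact lt_of_lt_of_le h' hω

theorem InfluenceFunction.IsBigOP.add (hX : IsBigOP P X) (hY : IsBigOP P Y) :
    IsBigOP P fun n ω => X n ω + Y n ω := by
  intro η hη
  obtain ⟨K, hK⟩ := hX (η / 2) (ENNReal.half_pos hη.ne')
  obtain ⟨K', hK'⟩ := hY (η / 2) (ENNReal.half_pos hη.ne')
  refine ⟨K + K', ?_⟩
  filter_upwards [hK, hK'] with n hn hn'
  rw [← ENNReal.add_halves η]
  refine (measure_mono ?_).trans ((measure_union_le _ _).trans (add_le_add hn hn'))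
  intro ω hω
  by_contra hcon
  simp only [Set.mem_union, Set.mem_ofPred_eq, not_or, not_lt, ENNReal.coe_add] at hcon hω
  exact absurd hω (not_lt.2 (add_le_add hcon.1 hcon.2))

theorem InfluenceFunction.IsBigOP.const (c : ℝ≥0) : IsBigOP P fun _ _ => c := by
  intro η _
  exact ⟨c, Eventually.of_forall fun n => by simp⟩

theorem InfluenceFunction.IsBigOP.sum {ι : Type*} (s : Finset ι) {X : ι → ∀ n, Ω n → ℝ≥0∞}
    (h : ∀ i ∈ s, IsBigOP P (X i)) : IsBigOP P fun n ω => ∑ i ∈ s, X i n ω := by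
  classical
  induction s using Finset.induction_on with
  | empty => simpa using IsBigOP.const (P := P) 0
  | insert a s ha ih =>
    simp only [Finset.sum_insert ha]
    exact (h a (by simp)).add (ih fun i hi => h i (by simp [hi]))

end StochasticOrder

/-! ### Sums over independent and identically distributed observations -/

section Sums

variable {𝒵 Ω : Type*} [MeasurableSpace 𝒵] [MeasurableSpace Ω] {μ : Measure 𝒵} {P : Measure Ω}

theorem ae_comp_of_hasLaw {Z : Ω → 𝒵} (h : HasLaw Z μ P) {p : 𝒵 → Prop} (hp : ∀ᵐ z ∂μ, p z) :
    ∀ᵐ ω ∂P, p (Z ω) := by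
  rw [← h.map_eq] at hp
  exact ae_of_ae_map h.aemeasurable hp

/-- Chebyshev's inequality for a sum of independent observations. -/
theorem measure_abs_sum_sub_ge_le [IsProbabilityMeasure μ] [IsProbabilityMeasure P] {n : ℕ}
    {Z : Fin n → Ω → 𝒵} (hi : iIndepFun Z P) (hl : ∀ i, HasLaw (Z i) μ P) {ξ : 𝒵 → ℝ}
    (hξ : MemLp ξ 2 μ) {K : ℝ} (hK : ∫ z, ξ z ^ 2 ∂μ ≤ K) {δ : ℝ} (hδ : 0 < δ) :
    P {ω | δ ≤ |∑ i, ξ (Z i ω) - n * ∫ z, ξ z ∂μ|} ≤ ENNReal.ofReal (n * K / δ ^ 2) := by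
  have hmem : ∀ i, MemLp (fun ω => ξ (Z i ω)) 2 P := fun i =>
    MemLp.comp_of_map (f := Z i) (by rwa [(hl i).map_eq]) (hl i).aemeasurable
  have hmean : ∀ i, ∫ ω, ξ (Z i ω) ∂P = ∫ z, ξ z ∂μ := fun i =>
    (hl i).integral_comp hξ.aestronglyMeasurable
  have hvar : ∀ i, Var[fun ω => ξ (Z i ω); P] ≤ K := fun i => by
    refine (variance_le_expectation_sq (hmem i).aestronglyMeasurable).trans ?_
    refine Eq.trans_le ?_ hK
    exact (hl i).integral_comp (f := fun z => ξ z ^ 2) (hξ.aestronglyMeasurable.pow 2)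
  have hindep : iIndepFun (fun i ω => ξ (Z i ω)) P :=
    hi.comp₀ (fun _ => ξ) (fun i => (hl i).aemeasurable)
      (fun i => by rw [(hl i).map_eq]; exact hξ.aestronglyMeasurable.aemeasurable)
  have hsum : MemLp (fun ω => ∑ i, ξ (Z i ω)) 2 P := memLp_finsetSum _ fun i _ => hmem i
  have hE : ∫ ω, ∑ i, ξ (Z i ω) ∂P = n * ∫ z, ξ z ∂μ := by
    rw [integral_finsetSum _ fun i _ => (hmem i).integrable one_le_two]
    simp [hmean]
  have hV : Var[fun ω => ∑ i, ξ (Z i ω); P] ≤ n * K := by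
    have := IndepFun.variance_sum (s := Finset.univ) (X := fun i ω => ξ (Z i ω)) (μ := P)
      (fun i _ => hmem i) (fun i _ j _ hij => hindep.indepFun hij)
    have e : (∑ i, fun ω => ξ (Z i ω)) = fun ω => ∑ i, ξ (Z i ω) := by ext; simp
    rw [e] at this
    rw [this]
    calc _ ≤ ∑ _i : Fin n, K := Finset.sum_le_sum fun i _ => hvar i
      _ = _ := by simp
  have := meas_ge_le_variance_div_sq hsum hδ
  rw [hE] at this
  exact this.trans (ENNReal.ofReal_le_ofReal (by gcongr))

end Sums

section TriangularArray

variable {𝒵 : Type*} [MeasurableSpace 𝒵] {Ω : ℕ → Type*} [∀ n, MeasurableSpace (Ω n)]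
  {μ : ℕ → Measure 𝒵} [∀ n, IsProbabilityMeasure (μ n)]
  {P : ∀ n, Measure (Ω n)} {Z : ∀ n, Fin n → Ω n → 𝒵}

/-- Weak law of large numbers for a triangular array with bounded second moments. -/
theorem isLittleOP_average_sub_integral [∀ n, IsProbabilityMeasure (P n)]
    (hi : ∀ n, iIndepFun (Z n) (P n))
    (hl : ∀ n i, HasLaw (Z n i) (μ n) (P n)) {ξ : ℕ → 𝒵 → ℝ} {K : ℝ}
    (hξ : ∀ᶠ n in atTop, MemLp (ξ n) 2 (μ n) ∧ ∫ z, ξ n z ^ 2 ∂μ n ≤ K) :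
    IsLittleOP P fun n ω => ‖(n : ℝ)⁻¹ * ∑ i, ξ n (Z n i ω) - ∫ z, ξ n z ∂μ n‖ₑ := by
  intro δ hδ
  by_cases hδt : δ = ⊤
  · simp [hδt]
  lift δ to ℝ≥0 using hδt
  have hδ' : 0 < (δ : ℝ) := by exact_mod_cast hδ
  have hlim : Tendsto (fun n : ℕ => ENNReal.ofReal (K / δ ^ 2 * (n : ℝ)⁻¹)) atTop (𝓝 0) := by
    rw [← ENNReal.ofReal_zero]
    refine ENNReal.tendsto_ofReal ?_
    simpa using (tendsto_inv_atTop_zero.comp (tendsto_natCast_atTop_atTop (R := ℝ))).const_mul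
      (K / (δ : ℝ) ^ 2)
  refine tendsto_of_tendsto_of_tendsto_of_le_of_le' tendsto_const_nhds hlim
    (Eventually.of_forall fun _ => zero_le) ?_
  filter_upwards [hξ, eventually_gt_atTop 0] with n hn hn0
  have hn' : (0 : ℝ) < n := by exact_mod_cast hn0
  have := measure_abs_sum_sub_ge_le (hi n) (hl n) hn.1 hn.2 (mul_pos hn' hδ')
  refine (measure_mono fun ω hω => ?_).trans (this.trans_eq ?_)
  · simp only [Set.mem_ofPred_eq] at hω ⊢
    rw [Real.enorm_eq_ofReal_abs, ← ENNReal.ofReal_coe_nnreal,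
      ENNReal.ofReal_le_ofReal_iff (abs_nonneg _)] at hω
    calc (n : ℝ) * δ ≤ n * |(n : ℝ)⁻¹ * ∑ i, ξ n (Z n i ω) - ∫ z, ξ n z ∂μ n| := by gcongr
      _ = |n * ((n : ℝ)⁻¹ * ∑ i, ξ n (Z n i ω) - ∫ z, ξ n z ∂μ n)| := by
        rw [abs_mul, abs_of_pos hn']
      _ = _ := by congr 1; field_simp
  · congr 1; field_simp

/-- The normalized sum of centred variables with bounded second moments is bounded in
probability. -/
theorem isBigOP_normalized_sum [∀ n, IsProbabilityMeasure (P n)]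
    (hi : ∀ n, iIndepFun (Z n) (P n))
    (hl : ∀ n i, HasLaw (Z n i) (μ n) (P n)) {ξ : ℕ → 𝒵 → ℝ} {K : ℝ}
    (hξ : ∀ᶠ n in atTop, MemLp (ξ n) 2 (μ n) ∧ ∫ z, ξ n z ^ 2 ∂μ n ≤ K ∧ ∫ z, ξ n z ∂μ n = 0) :
    IsBigOP P fun n ω => ‖(√(n : ℝ))⁻¹ * ∑ i, ξ n (Z n i ω)‖ₑ := by
  intro η hη
  obtain ⟨k, hk0, hk⟩ : ∃ k : ℝ≥0, 0 < k ∧ ENNReal.ofReal (K / k ^ 2) ≤ η := by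
    have hlim : Tendsto (fun k : ℕ => ENNReal.ofReal (K * ((k : ℝ)⁻¹) ^ 2)) atTop (𝓝 0) := by
      rw [← ENNReal.ofReal_zero]
      refine ENNReal.tendsto_ofReal ?_
      simpa using ((tendsto_inv_atTop_zero.comp
        (tendsto_natCast_atTop_atTop (R := ℝ))).pow 2).const_mul K
    obtain ⟨k, hk, hk0⟩ := ((hlim.eventually (ge_mem_nhds hη)).and (eventually_gt_atTop 0)).exists
    refine ⟨k, by exact_mod_cast hk0, ?_⟩
    simpa [div_eq_mul_inv] using hk
  have hk0' : 0 < (k : ℝ) := by exact_mod_cast hk0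
  refine ⟨k, ?_⟩
  filter_upwards [hξ, eventually_gt_atTop 0] with n hn hn0
  have hn' : (0 : ℝ) < n := by exact_mod_cast hn0
  have := measure_abs_sum_sub_ge_le (hi n) (hl n) hn.1 hn.2.1
    (mul_pos (Real.sqrt_pos.2 hn') hk0')
  rw [hn.2.2, mul_zero] at this
  refine (measure_mono fun ω hω => ?_).trans (this.trans ((Eq.le ?_).trans hk))
  · simp only [Set.mem_ofPred_eq, sub_zero] at hω ⊢
    rw [Real.enorm_eq_ofReal_abs, ← ENNReal.ofReal_coe_nnreal,
      ENNReal.ofReal_lt_ofReal_iff_of_nonneg hk0'.le, abs_mul, abs_inv,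
      abs_of_nonneg (Real.sqrt_nonneg _), inv_mul_eq_div, lt_div_iff₀ (by positivity)] at hω
    linarith
  · congr 1
    rw [mul_pow, Real.sq_sqrt hn'.le]
    field_simp

/-- The average of the envelope is bounded in probability, so it vanishes after division by
`√n`. -/
theorem isLittleOP_scaled_average {G : ℕ → 𝒵 → ℝ} {K : ℝ≥0}
    (hl : ∀ n i, HasLaw (Z n i) (μ n) (P n))
    (hG : ∀ n, 0 < n → AEMeasurable (G n) (μ n) ∧ ∫⁻ z, ‖G n z‖ₑ ^ 2 ∂μ n ≤ K) :
    IsLittleOP P fun n ω => ‖(√(n : ℝ))⁻¹ * ((n : ℝ)⁻¹ * ∑ i, G n (Z n i ω))‖ₑ := by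
  have hmeas : ∀ n, 0 < n → ∀ i, AEMeasurable (fun ω => G n (Z n i ω)) (P n) := fun n hn i =>
    AEMeasurable.comp_aemeasurable (by rw [(hl n i).map_eq]; exact (hG n hn).1)
      (hl n i).aemeasurable
  refine IsLittleOP.of_lintegral ?_ ?_
  · filter_upwards [eventually_gt_atTop 0] with n hn
    exact (((Finset.aemeasurable_fun_sum _ fun i _ => hmeas n hn i).const_mul _).const_mul _).enorm
  have hlim : Tendsto (fun n : ℕ => ENNReal.ofReal (√(n : ℝ))⁻¹ * (1 + K)) atTop (𝓝 0) := by
    rw [← zero_mul (1 + (K : ℝ≥0∞)), ← ENNReal.ofReal_zero]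
    refine ENNReal.Tendsto.mul_const (ENNReal.tendsto_ofReal ?_) (Or.inr (by simp))
    exact tendsto_inv_atTop_zero.comp
      (Real.tendsto_sqrt_atTop.comp (tendsto_natCast_atTop_atTop (R := ℝ)))
  refine tendsto_of_tendsto_of_tendsto_of_le_of_le' tendsto_const_nhds hlim
    (Eventually.of_forall fun _ => zero_le) ?_
  filter_upwards [eventually_gt_atTop 0] with n hn
  have hn' : (0 : ℝ) < n := by exact_mod_cast hn
  have h1 : ∀ i, ∫⁻ ω, ‖G n (Z n i ω)‖ₑ ∂P n ≤ 1 + K := fun i => by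
    rw [(hl n i).lintegral_comp (f := fun z => ‖G n z‖ₑ) (hG n hn).1.enorm]
    calc _ ≤ ∫⁻ z, (1 + ‖G n z‖ₑ ^ 2) ∂μ n := by
          refine lintegral_mono fun z => ?_
          rcases le_total (‖G n z‖ₑ) 1 with h | h
          · exact h.trans le_self_add
          · refine le_trans ?_ le_add_self
            calc ‖G n z‖ₑ = ‖G n z‖ₑ ^ 1 := (pow_one _).symm
              _ ≤ _ := pow_le_pow_right₀ h one_le_two
      _ ≤ _ := by
          rw [lintegral_add_left measurable_const]
          simpa using (hG n hn).2
  calc _ ≤ ∫⁻ ω, ENNReal.ofReal (√(n : ℝ))⁻¹ * (ENNReal.ofReal (n : ℝ)⁻¹ *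
        ∑ i, ‖G n (Z n i ω)‖ₑ) ∂P n := by
        refine lintegral_mono fun ω => ?_
        rw [enorm_mul, enorm_mul, Real.enorm_of_nonneg (by positivity),
          Real.enorm_of_nonneg (by positivity)]
        gcongr
        exact enorm_sum_le _ _
    _ = ENNReal.ofReal (√(n : ℝ))⁻¹ * (ENNReal.ofReal (n : ℝ)⁻¹ *
        ∑ i, ∫⁻ ω, ‖G n (Z n i ω)‖ₑ ∂P n) := by
        rw [lintegral_const_mul' _ _ ENNReal.ofReal_ne_top,
          lintegral_const_mul' _ _ ENNReal.ofReal_ne_top,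
          lintegral_finsetSum' _ fun i _ => (hmeas n hn i).enorm]
    _ ≤ ENNReal.ofReal (√(n : ℝ))⁻¹ *
        (ENNReal.ofReal (n : ℝ)⁻¹ * ∑ _i : Fin n, (1 + (K : ℝ≥0∞))) := by
        gcongr with i
        exact h1 i
    _ = _ := by
        rw [Finset.sum_const, Finset.card_univ, Fintype.card_fin, nsmul_eq_mul, ← mul_assoc
          (ENNReal.ofReal (n : ℝ)⁻¹), ENNReal.ofReal_inv_of_pos hn', ENNReal.ofReal_natCast,
          ENNReal.inv_mul_cancel (by exact_mod_cast hn.ne') (by simp), one_mul]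

end TriangularArray

/-! ### Stability of minimizers of convex functions -/

section Minimizers

/-- A convex function that is larger on a sphere than at the centre `p` has a minimizer, and all its
minimizers lie in the ball. -/
theorem ConvexOn.exists_isMinOn_of_lt_sphere {E : Type*} [NormedAddCommGroup E] [NormedSpace ℝ E]
    [FiniteDimensional ℝ E] {f : E → ℝ} (hf : ConvexOn ℝ Set.univ f) {p : E} {δ : ℝ} (hδ : 0 < δ)
    (h : ∀ x, ‖x - p‖ = δ → f p < f x) :
    (∃ y, IsMinOn f Set.univ y) ∧ ∀ y, IsMinOn f Set.univ y → ‖y - p‖ ≤ δ := by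
  have hout : ∀ x, δ ≤ ‖x - p‖ → f p < f x := by
    intro x hx
    have hpos : 0 < ‖x - p‖ := hδ.trans_le hx
    set t := δ / ‖x - p‖ with ht
    have ht0 : 0 < t := by positivity
    have ht1 : t ≤ 1 := (div_le_one hpos).2 hx
    have h1 := h ((1 - t) • p + t • x) (by
      rw [show (1 - t) • p + t • x - p = t • (x - p) by module, norm_smul,
        Real.norm_of_nonneg ht0.le, ht, div_mul_cancel₀ _ hpos.ne'])
    have h2 := hf.2 (Set.mem_univ p) (Set.mem_univ x) (sub_nonneg.2 ht1) ht0.le (by ring)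
    simp only [smul_eq_mul] at h2
    nlinarith
  have hc : Continuous f := by
    rw [← continuousOn_univ]; exact hf.continuousOn isOpen_univ
  constructor
  · obtain ⟨y, hy, hmin⟩ := (isCompact_closedBall p δ).exists_isMinOn
      ⟨p, Metric.mem_closedBall_self hδ.le⟩ hc.continuousOn
    refine ⟨y, fun x _ => ?_⟩
    by_cases hx : ‖x - p‖ ≤ δ
    · exact hmin (by simpa [dist_eq_norm] using hx)
    · exact (hmin (Metric.mem_closedBall_self hδ.le)).trans (hout x (not_le.1 hx).le).le
  · intro y hy
    by_contra hcon
    exact absurd (hy (Set.mem_univ p)) (not_le.2 (hout y (not_le.1 hcon).le))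

theorem norm_le_of_isMinOn_half_norm_sq_add {E : Type*} [NormedAddCommGroup E] {ψ : E → ℝ}
    (hψ0 : IsMinOn ψ Set.univ 0) {x g : E}
    (hg : IsMinOn (fun g => 1 / 2 * ‖g‖ ^ 2 + ψ (x + g)) Set.univ g) : ‖g‖ ≤ ‖x‖ := by
  have h1 : 1 / 2 * ‖g‖ ^ 2 + ψ (x + g) ≤ 1 / 2 * ‖-x‖ ^ 2 + ψ (x + -x) := hg (Set.mem_univ (-x))
  have h2 : ψ 0 ≤ ψ (x + g) := hψ0 (Set.mem_univ _)
  rw [norm_neg, add_neg_cancel] at h1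
  exact le_of_sq_le_sq (by linarith) (norm_nonneg x)

theorem isMinOn_argmin {E : Type*} [Nonempty E] {f : E → ℝ} (h : ∃ y, IsMinOn f Set.univ y) :
    IsMinOn f Set.univ (argmin f) :=
  Classical.epsilon_spec (p := fun x => IsMinOn f Set.univ x) h

variable {E : Type*} [NormedAddCommGroup E] [InnerProductSpace ℝ E]

theorem convexOn_half_norm_sq_add {ψ : E → ℝ} (hψ : ConvexOn ℝ Set.univ ψ) (x : E) :
    ConvexOn ℝ Set.univ fun g => 1 / 2 * ‖g‖ ^ 2 + ψ (x + g) := by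
  have h1 : ConvexOn ℝ Set.univ fun g : E => 1 / 2 * ‖g‖ ^ 2 :=
    ((convexOn_univ_norm (E := E)).pow (fun _ _ => norm_nonneg _) 2).smul (by norm_num)
  have h2 := hψ.translate_right x
  rw [Set.preimage_univ] at h2
  exact h1.add h2

/-- Quadratic growth of the proximal objective at its minimizer. -/
theorem half_norm_sub_sq_le_of_isMinOn {ψ : E → ℝ} (hψ : ConvexOn ℝ Set.univ ψ) {x g : E}
    (hg : IsMinOn (fun g => 1 / 2 * ‖g‖ ^ 2 + ψ (x + g)) Set.univ g) (h : E) :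
    1 / 2 * ‖g‖ ^ 2 + ψ (x + g) + 1 / 2 * ‖h - g‖ ^ 2 ≤ 1 / 2 * ‖h‖ ^ 2 + ψ (x + h) := by
  set a := 1 / 2 * ‖h - g‖ ^ 2 with ha
  set b := (1 / 2 * ‖h‖ ^ 2 + ψ (x + h)) - (1 / 2 * ‖g‖ ^ 2 + ψ (x + g)) with hb
  have hb0 : 0 ≤ b := sub_nonneg.2 (hg (Set.mem_univ h))
  suffices hab : a ≤ b by linarith
  have key : ∀ t : ℝ, 0 < t → t ≤ 1 → a * (1 - t) ≤ b := by
    intro t ht ht1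
    have h1 : 1 / 2 * ‖g‖ ^ 2 + ψ (x + g) ≤
        1 / 2 * ‖g + t • (h - g)‖ ^ 2 + ψ (x + (g + t • (h - g))) := hg (Set.mem_univ _)
    have h2 := hψ.2 (Set.mem_univ (x + g)) (Set.mem_univ (x + h)) (sub_nonneg.2 ht1) ht.le (by ring)
    rw [show (1 - t) • (x + g) + t • (x + h) = x + (g + t • (h - g)) by module] at h2
    simp only [smul_eq_mul] at h2
    have h3 : ‖g + t • (h - g)‖ ^ 2 =
        (1 - t) * ‖g‖ ^ 2 + t * ‖h‖ ^ 2 - t * (1 - t) * ‖h - g‖ ^ 2 := by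
      have e1 := norm_add_sq_real g (t • (h - g))
      have e2 := norm_sub_sq_real h g
      rw [norm_smul, inner_smul_right, inner_sub_right, real_inner_self_eq_norm_sq, mul_pow,
        Real.norm_eq_abs, sq_abs, real_inner_comm] at e1
      rw [e1, e2]
      ring
    rw [h3] at h1
    have h4 : t * (a * (1 - t)) ≤ t * b := by rw [ha, hb]; linarith
    exact le_of_mul_le_mul_left h4 ht
  by_contra hcon
  rw [not_le] at hcon
  have ha0 : 0 < a := hb0.trans_lt hcon
  have := key ((a - b) / (2 * a)) (by apply div_pos <;> linarith)
    (by rw [div_le_one (by linarith)]; linarith)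
  have e : a * (1 - (a - b) / (2 * a)) = (a + b) / 2 := by field_simp; ring
  rw [e] at this
  linarith

variable [FiniteDimensional ℝ E]

theorem exists_isMinOn_half_norm_sq_add {ψ : E → ℝ} (hψ : ConvexOn ℝ Set.univ ψ)
    (hψ0 : IsMinOn ψ Set.univ 0) (x : E) :
    ∃ g, IsMinOn (fun g => 1 / 2 * ‖g‖ ^ 2 + ψ (x + g)) Set.univ g := by
  have hle : ∀ y, ψ 0 ≤ ψ y := fun y => hψ0 (Set.mem_univ y)
  -- the quadratic term outweighs `ψ x - ψ 0` on the sphere of this radius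
  set R := 1 + 2 * (ψ x - ψ 0) with hR
  have hR1 : 1 ≤ R := by linarith [hle x]
  refine ((convexOn_half_norm_sq_add hψ x).exists_isMinOn_of_lt_sphere (p := 0)
    (δ := R) (by linarith) fun g hg => ?_).1
  rw [sub_zero] at hg
  rw [hg, norm_zero, add_zero]
  nlinarith [hle (x + g)]

/-- If a convex function is uniformly close to a quadratic, then adding a convex penalty to it moves
the minimizer close to the proximal point of the quadratic. -/
theorem norm_sub_sub_le_of_isArgmin {L ε ψ : E → ℝ} {x g q : E} {c C δ η : ℝ}
    (hL : ConvexOn ℝ Set.univ L) (hψ : ConvexOn ℝ Set.univ ψ) (hψ0 : IsMinOn ψ Set.univ 0)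
    (hLε : ∀ θ, L θ = c + 1 / 2 * ‖θ - x‖ ^ 2 + ε θ)
    (hε : ∀ θ, ‖θ‖ ≤ C → |ε θ| ≤ η) (hδ : 0 < δ) (hη : 4 * η < δ ^ 2)
    (hC : 2 * ‖x‖ + δ ≤ C)
    (hg : IsMinOn (fun g => 1 / 2 * ‖g‖ ^ 2 + ψ (x + g)) Set.univ g)
    (hq : IsArgmin (fun θ => L θ + ψ θ) q) : ‖q - x - g‖ ≤ δ := by
  have hgx : ‖g‖ ≤ ‖x‖ := norm_le_of_isMinOn_half_norm_sq_add hψ0 hg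
  have hp : ‖x + g‖ ≤ 2 * ‖x‖ := (norm_add_le _ _).trans (by linarith)
  have hconv : ConvexOn ℝ Set.univ fun θ => L θ + ψ θ := hL.add hψ
  obtain ⟨hex, hall⟩ := hconv.exists_isMinOn_of_lt_sphere (p := x + g) hδ fun θ hθ => by
    have h1 := half_norm_sub_sq_le_of_isMinOn hψ hg (θ - x)
    rw [show θ - x - g = θ - (x + g) by abel, hθ, add_sub_cancel] at h1
    have h2 := abs_le.1 (hε (x + g) (hp.trans (by linarith)))
    have hθn : ‖θ‖ ≤ C := by
      calc ‖θ‖ = ‖(θ - (x + g)) + (x + g)‖ := by rw [sub_add_cancel]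
        _ ≤ ‖θ - (x + g)‖ + ‖x + g‖ := norm_add_le _ _
        _ ≤ C := by linarith
    have h3 := abs_le.1 (hε θ hθn)
    rw [hLε, hLε, add_sub_cancel_left]
    linarith
  rw [sub_sub]
  exact hall q (hq hex)

end Minimizers

/-! ### Limits of the expected score and Hessian -/

section Moments

variable {d : ℕ} {𝒵 : Type*}

/-- The derivative `D_β l` at the point `θ₀ / √n`, as a linear form. -/
noncomputable def scoreForm (l : EuclideanSpace ℝ (Fin d) → 𝒵 → ℝ)
    (θ₀ : EuclideanSpace ℝ (Fin d)) (n : ℕ) (z : 𝒵) : EuclideanSpace ℝ (Fin d) →L[ℝ] ℝ :=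
  fderiv ℝ (fun β => l β z) ((√(n : ℝ))⁻¹ • θ₀)

/-- The Hessian `D²_β l` at the point `θ₀ / √n`, as a bilinear form. -/
noncomputable def hessianForm (l : EuclideanSpace ℝ (Fin d) → 𝒵 → ℝ)
    (θ₀ : EuclideanSpace ℝ (Fin d)) (n : ℕ) (z : 𝒵) :
    EuclideanSpace ℝ (Fin d) →L[ℝ] EuclideanSpace ℝ (Fin d) →L[ℝ] ℝ :=
  fderiv ℝ (fderiv ℝ fun β => l β z) ((√(n : ℝ))⁻¹ • θ₀)

/-- `G n` is an envelope with uniformly bounded second moments for the first three derivatives of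
the loss on the ball of radius `ρ` around `β = 0`. -/
structure DerivativeEnvelope [MeasurableSpace 𝒵] (l : EuclideanSpace ℝ (Fin d) → 𝒵 → ℝ)
    (μ : ℕ → Measure 𝒵) (ρ : ℝ) (K : ℝ≥0) (G : ℕ → 𝒵 → ℝ) : Prop where
  pos : 0 < ρ
  aemeasurable : ∀ n, 0 < n → AEMeasurable (G n) (μ n)
  moment : ∀ n, 0 < n → ∫⁻ z, ‖G n z‖ₑ ^ 2 ∂μ n ≤ K
  taylor : ∀ n, 0 < n → ∀ᵐ z ∂μ n, TaylorControl (fun β => l β z) ρ (G n z)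

theorem eventually_inv_sqrt_smul_mem_ball {ρ : ℝ} (hρ : 0 < ρ) (C : ℝ) :
    ∀ᶠ n : ℕ in atTop, ∀ θ : EuclideanSpace ℝ (Fin d), ‖θ‖ ≤ C →
      (√(n : ℝ))⁻¹ • θ ∈ Metric.ball 0 ρ := by
  have h : Tendsto (fun n : ℕ => (√(n : ℝ))⁻¹ * C) atTop (𝓝 0) := by
    simpa using (tendsto_inv_atTop_zero.comp
      (Real.tendsto_sqrt_atTop.comp (tendsto_natCast_atTop_atTop (R := ℝ)))).mul_const C
  filter_upwards [h.eventually (gt_mem_nhds hρ)] with n hn θ hθ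
  rw [mem_ball_zero_iff, norm_smul, Real.norm_of_nonneg (by positivity)]
  exact (mul_le_mul_of_nonneg_left hθ (by positivity)).trans_lt hn

variable [MeasurableSpace 𝒵] {l : EuclideanSpace ℝ (Fin d) → 𝒵 → ℝ} {μ : ℕ → Measure 𝒵}
  {ρ : ℝ} {K : ℝ≥0} {G : ℕ → 𝒵 → ℝ} {n : ℕ} {θ₀ : EuclideanSpace ℝ (Fin d)}

namespace DerivativeEnvelope

theorem memLp (hG : DerivativeEnvelope l μ ρ K G) (hn : 0 < n) : MemLp (G n) 2 (μ n) := by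
  refine ⟨(hG.aemeasurable n hn).aestronglyMeasurable, ?_⟩
  rw [eLpNorm_lt_top_iff_lintegral_rpow_enorm_lt_top (by simp) (by simp)]
  simpa using (hG.moment n hn).trans_lt ENNReal.coe_lt_top

theorem integral_sq_le (hG : DerivativeEnvelope l μ ρ K G) (hn : 0 < n) :
    ∫ z, G n z ^ 2 ∂μ n ≤ K := by
  rw [integral_eq_lintegral_of_nonneg_ae (Eventually.of_forall fun z => sq_nonneg _)
    ((hG.aemeasurable n hn).pow_const 2).aestronglyMeasurable]
  refine ENNReal.toReal_le_coe_of_le_coe ((Eq.le ?_).trans (hG.moment n hn))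
  refine lintegral_congr fun z => ?_
  rw [Real.enorm_eq_ofReal_abs, ← ENNReal.ofReal_pow (abs_nonneg _), sq_abs]

theorem memLp_of_le (hG : DerivativeEnvelope l μ ρ K G) (hn : 0 < n) {ξ : 𝒵 → ℝ}
    (hξ : AEStronglyMeasurable ξ (μ n)) {c : ℝ}
    (hle : ∀ᵐ z ∂μ n, |ξ z| ≤ c * G n z) :
    MemLp ξ 2 (μ n) ∧ ∫ z, ξ z ^ 2 ∂μ n ≤ c ^ 2 * K := by
  have hmem := hG.memLp hn
  have hcmem : MemLp (fun z => c * G n z) 2 (μ n) := hmem.const_mul c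
  have hξmem : MemLp ξ 2 (μ n) := hcmem.of_le hξ (by
    filter_upwards [hle] with z hz
    exact (Real.norm_eq_abs _).trans_le (hz.trans (le_abs_self _)))
  refine ⟨hξmem, ?_⟩
  calc ∫ z, ξ z ^ 2 ∂μ n ≤ ∫ z, c ^ 2 * G n z ^ 2 ∂μ n := by
        refine integral_mono_ae hξmem.integrable_sq (hmem.integrable_sq.const_mul _) ?_
        filter_upwards [hle] with z hz
        rw [← mul_pow, ← sq_abs (ξ z)]
        exact pow_le_pow_left₀ (abs_nonneg _) hz 2
    _ = c ^ 2 * ∫ z, G n z ^ 2 ∂μ n := integral_const_mul _ _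
    _ ≤ _ := mul_le_mul_of_nonneg_left (hG.integral_sq_le hn) (sq_nonneg c)

theorem integrable [∀ n, IsProbabilityMeasure (μ n)] (hG : DerivativeEnvelope l μ ρ K G)
    (hn : 0 < n) : Integrable (G n) (μ n) :=
  (hG.memLp hn).integrable one_le_two

theorem integral_le [∀ n, IsProbabilityMeasure (μ n)] (hG : DerivativeEnvelope l μ ρ K G)
    (hn : 0 < n) : ∫ z, G n z ∂μ n ≤ 1 + K := by
  have hi := hG.integrable hn
  have hi2 := (hG.memLp hn).integrable_sq
  calc ∫ z, G n z ∂μ n ≤ ∫ z, (1 + G n z ^ 2) ∂μ n :=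
        integral_mono hi ((integrable_const 1).add hi2) fun z => by
          show G n z ≤ 1 + G n z ^ 2
          nlinarith [sq_nonneg (G n z - 1 / 2)]
    _ = 1 + ∫ z, G n z ^ 2 ∂μ n := by rw [integral_add (integrable_const 1) hi2]; simp
    _ ≤ _ := by linarith [hG.integral_sq_le hn]

theorem aestronglyMeasurable_fderiv (hG : DerivativeEnvelope l μ ρ K G)
    (hl : ∀ β, Measurable (l β)) (hn : 0 < n) (β : EuclideanSpace ℝ (Fin d)) :
    AEStronglyMeasurable (fun z => fderiv ℝ (fun β => l β z) β) (μ n) :=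
  aestronglyMeasurable_fderiv_of_param (fun a => (hl a).aestronglyMeasurable)
    ((hG.taylor n hn).mono fun _ h => h.differentiable) β

theorem aestronglyMeasurable_hessianForm (hG : DerivativeEnvelope l μ ρ K G)
    (hl : ∀ β, Measurable (l β)) (hn : 0 < n) :
    AEStronglyMeasurable (hessianForm l θ₀ n) (μ n) :=
  aestronglyMeasurable_fderiv_of_param (hG.aestronglyMeasurable_fderiv hl hn)
    ((hG.taylor n hn).mono fun _ h => h.differentiable_fderiv) _

theorem memLp_scoreForm (hG : DerivativeEnvelope l μ ρ K G) (hl : ∀ β, Measurable (l β))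
    (hn : 0 < n) (hball : (√(n : ℝ))⁻¹ • θ₀ ∈ Metric.ball 0 ρ) (v : EuclideanSpace ℝ (Fin d)) :
    MemLp (fun z => scoreForm l θ₀ n z v) 2 (μ n) ∧
      ∫ z, scoreForm l θ₀ n z v ^ 2 ∂μ n ≤ ‖v‖ ^ 2 * K := by
  refine hG.memLp_of_le hn ((ContinuousLinearMap.apply ℝ ℝ v).continuous.comp_aestronglyMeasurable
    (hG.aestronglyMeasurable_fderiv hl hn _)) ?_
  filter_upwards [hG.taylor n hn] with z hz
  rw [mul_comm]
  exact ((scoreForm l θ₀ n z).le_opNorm v).trans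
    (mul_le_mul_of_nonneg_right (hz.norm_fderiv_le _ hball) (norm_nonneg v))

theorem memLp_hessianForm (hG : DerivativeEnvelope l μ ρ K G) (hl : ∀ β, Measurable (l β))
    (hn : 0 < n) (hball : (√(n : ℝ))⁻¹ • θ₀ ∈ Metric.ball 0 ρ) (v w : EuclideanSpace ℝ (Fin d)) :
    MemLp (fun z => hessianForm l θ₀ n z v w) 2 (μ n) ∧
      ∫ z, hessianForm l θ₀ n z v w ^ 2 ∂μ n ≤ (‖v‖ * ‖w‖) ^ 2 * K := by
  refine hG.memLp_of_le hn ((ContinuousLinearMap.apply ℝ ℝ w).continuous.comp_aestronglyMeasurable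
    ((ContinuousLinearMap.apply ℝ (_ →L[ℝ] ℝ) v).continuous.comp_aestronglyMeasurable
      (hG.aestronglyMeasurable_hessianForm hl hn))) ?_
  filter_upwards [hG.taylor n hn] with z hz
  calc _ ≤ ‖hessianForm l θ₀ n z‖ * ‖v‖ * ‖w‖ := (hessianForm l θ₀ n z).le_opNorm₂ v w
    _ ≤ G n z * ‖v‖ * ‖w‖ := by gcongr; exact hz.norm_hessian_le _ hball
    _ = _ := by ring

/-- The score has mean zero at a minimizer of the expected loss. -/
theorem integral_scoreForm_eq_zero [∀ n, IsProbabilityMeasure (μ n)]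
    (hG : DerivativeEnvelope l μ ρ K G) (hl : ∀ β, Measurable (l β))
    (hint : ∀ β, Integrable (l β) (μ n))
    (hmin : IsMinOn (fun θ => ∫ z, localLoss l n θ z ∂μ n) Set.univ θ₀)
    (hn : 0 < n) (hball : (√(n : ℝ))⁻¹ • θ₀ ∈ Metric.ball 0 ρ) (v : EuclideanSpace ℝ (Fin d)) :
    ∫ z, scoreForm l θ₀ n z v ∂μ n = 0 := by
  have hn' : (0 : ℝ) < n := by exact_mod_cast hn
  have hd : HasFDerivAt (fun β => ∫ z, l β z ∂μ n) (∫ z, scoreForm l θ₀ n z ∂μ n)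
      ((√(n : ℝ))⁻¹ • θ₀) :=
    hasFDerivAt_integral_of_dominated_of_fderiv_le
      (F' := fun β z => fderiv ℝ (fun β => l β z) β) (bound := G n)
      (Metric.isOpen_ball.mem_nhds hball)
      (Eventually.of_forall fun β => (hl β).aestronglyMeasurable) (hint _)
      (hG.aestronglyMeasurable_fderiv hl hn _)
      ((hG.taylor n hn).mono fun z h => h.norm_fderiv_le) (hG.integrable hn)
      ((hG.taylor n hn).mono fun z h β _ => (h.differentiable β).hasFDerivAt)
  have hmin' : IsLocalMin (fun β => ∫ z, l β z ∂μ n) ((√(n : ℝ))⁻¹ • θ₀) := by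
    refine Eventually.of_forall fun β => ?_
    have := hmin (Set.mem_univ (√(n : ℝ) • β))
    simpa only [Set.mem_ofPred_eq, localLoss, smul_smul,
      inv_mul_cancel₀ (Real.sqrt_pos.2 hn').ne', one_smul] using this
  have h0 := hmin'.hasFDerivAt_eq_zero hd
  have hi : Integrable (scoreForm l θ₀ n) (μ n) :=
    (hG.integrable hn).mono' (hG.aestronglyMeasurable_fderiv hl hn _)
      ((hG.taylor n hn).mono fun z h => h.norm_fderiv_le _ hball)
  rw [← ContinuousLinearMap.integral_apply hi, h0]
  rfl

/-- Second-order expansion of the expected loss. -/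
theorem abs_integral_sub_half_hessian_le [∀ n, IsProbabilityMeasure (μ n)]
    (hG : DerivativeEnvelope l μ ρ K G) (hl : ∀ β, Measurable (l β))
    (hint : ∀ β, Integrable (l β) (μ n))
    (hmin : IsMinOn (fun θ => ∫ z, localLoss l n θ z ∂μ n) Set.univ θ₀)
    (hn : 0 < n) (hball : (√(n : ℝ))⁻¹ • θ₀ ∈ Metric.ball 0 ρ) (h : EuclideanSpace ℝ (Fin d))
    (hball' : (√(n : ℝ))⁻¹ • (θ₀ + h) ∈ Metric.ball 0 ρ) :
    |n * ∫ z, (localLoss l n (θ₀ + h) z - localLoss l n θ₀ z) ∂μ n -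
      1 / 2 * ∫ z, hessianForm l θ₀ n z h h ∂μ n| ≤ (√(n : ℝ))⁻¹ * (‖h‖ ^ 3 * (1 + K)) := by
  have hn' : (0 : ℝ) < n := by exact_mod_cast hn
  set s := √(n : ℝ) with hs
  have hs0 : 0 < s := Real.sqrt_pos.2 hn'
  have hss : s ^ 2 = n := Real.sq_sqrt hn'.le
  have hsc := ((hG.memLp_scoreForm hl hn hball h).1).integrable one_le_two
  have hhe := ((hG.memLp_hessianForm hl hn hball h h).1).integrable one_le_two
  have hlo : Integrable (fun z => localLoss l n (θ₀ + h) z - localLoss l n θ₀ z) (μ n) :=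
    (hint _).sub (hint _)
  have e : n * ∫ z, (localLoss l n (θ₀ + h) z - localLoss l n θ₀ z) ∂μ n -
      1 / 2 * ∫ z, hessianForm l θ₀ n z h h ∂μ n =
      ∫ z, (n * (localLoss l n (θ₀ + h) z - localLoss l n θ₀ z) - s * scoreForm l θ₀ n z h -
        1 / 2 * hessianForm l θ₀ n z h h) ∂μ n := by
    have hd : Integrable (fun z => n * (localLoss l n (θ₀ + h) z - localLoss l n θ₀ z) -
        s * scoreForm l θ₀ n z h) (μ n) := (hlo.const_mul _).sub (hsc.const_mul _)
    rw [integral_sub hd (hhe.const_mul _), integral_sub (hlo.const_mul _) (hsc.const_mul _),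
      integral_const_mul, integral_const_mul, integral_const_mul,
      hG.integral_scoreForm_eq_zero hl hint hmin hn hball]
    ring
  rw [e, ← Real.norm_eq_abs]
  calc _ ≤ ∫ z, s⁻¹ * ‖h‖ ^ 3 * G n z ∂μ n := by
        refine norm_integral_le_of_norm_le ((hG.integrable hn).const_mul _) ?_
        filter_upwards [hG.taylor n hn] with z hz
        have := hz.abs_sub_le hball hball'
        rw [← smul_sub, add_sub_cancel_left, norm_smul, Real.norm_of_nonneg (by positivity)] at this
        simp only [map_smul, _root_.smul_apply, smul_eq_mul] at this
        have e2 : (n : ℝ) * (localLoss l n (θ₀ + h) z - localLoss l n θ₀ z) -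
            s * scoreForm l θ₀ n z h - 1 / 2 * hessianForm l θ₀ n z h h =
            n * (l (s⁻¹ • (θ₀ + h)) z - l (s⁻¹ • θ₀) z -
              s⁻¹ * fderiv ℝ (fun β => l β z) (s⁻¹ • θ₀) h -
              1 / 2 * (s⁻¹ * (s⁻¹ * fderiv ℝ (fderiv ℝ fun β => l β z) (s⁻¹ • θ₀) h h))) := by
          rw [← hss]
          simp only [localLoss, scoreForm, hessianForm, ← hs]
          field_simp
        rw [e2, norm_mul, Real.norm_of_nonneg hn'.le, Real.norm_eq_abs]
        calc _ ≤ (n : ℝ) * (G n z * (s⁻¹ * ‖h‖) ^ 3) := mul_le_mul_of_nonneg_left this hn'.le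
          _ = _ := by rw [← hss]; field_simp
    _ = s⁻¹ * (‖h‖ ^ 3 * ∫ z, G n z ∂μ n) := by rw [integral_const_mul]; ring
    _ ≤ _ := by gcongr; exact hG.integral_le hn

end DerivativeEnvelope

variable {Ω : ℕ → Type*} [∀ n, MeasurableSpace (Ω n)] {P : ∀ n, Measure (Ω n)}
  {Z : ∀ n, Fin n → Ω n → 𝒵} {Sig : Matrix (Fin d) (Fin d) ℝ} {Lbar : EuclideanSpace ℝ (Fin d) → ℝ}

theorem integral_empLoss_sub (hexp : Experiments l μ P Z θ₀ Sig) (hn : 0 < n)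
    (θ : EuclideanSpace ℝ (Fin d)) :
    ∫ ω, (empLoss l n (fun i => Z n i ω) θ - empLoss l n (fun i => Z n i ω) θ₀) ∂P n =
      n * ∫ z, (localLoss l n θ z - localLoss l n θ₀ z) ∂μ n := by
  have hint : Integrable (fun z => localLoss l n θ z - localLoss l n θ₀ z) (μ n) :=
    (hexp.integrable_loss n hn _).sub (hexp.integrable_loss n hn _)
  have h1 : ∀ i, Integrable (fun ω => localLoss l n θ (Z n i ω) - localLoss l n θ₀ (Z n i ω))
      (P n) := fun i =>
    Integrable.comp_aemeasurable (f := Z n i)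
      (g := fun z => localLoss l n θ z - localLoss l n θ₀ z)
      (by rwa [(hexp.law n i).map_eq]) (hexp.law n i).aemeasurable
  simp only [empLoss, ← Finset.sum_sub_distrib]
  rw [integral_finsetSum _ fun i _ => h1 i]
  have h2 : ∀ i, ∫ ω, (localLoss l n θ (Z n i ω) - localLoss l n θ₀ (Z n i ω)) ∂P n =
      ∫ z, (localLoss l n θ z - localLoss l n θ₀ z) ∂μ n := fun i =>
    (hexp.law n i).integral_comp (f := fun z => localLoss l n θ z - localLoss l n θ₀ z)
      hint.aestronglyMeasurable
  simp [h2]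

theorem ae_taylorControl (hexp : Experiments l μ P Z θ₀ Sig) (hG : DerivativeEnvelope l μ ρ K G)
    (hn : 0 < n) :
    ∀ᵐ ω ∂P n, ∀ i, TaylorControl (fun β => l β (Z n i ω)) ρ (G n (Z n i ω)) :=
  ae_all_iff.2 fun i => ae_comp_of_hasLaw (hexp.law n i) (hG.taylor n hn)

variable [∀ n, IsProbabilityMeasure (μ n)]

/-- The expected loss converges, and the cubic Taylor remainder contributes only `O(n ^ (-1/2))`. -/
theorem tendsto_integral_hessianForm_self (hexp : Experiments l μ P Z θ₀ Sig)
    (hnorm : NormalizedLoss l P Z θ₀ Lbar) (hG : DerivativeEnvelope l μ ρ K G)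
    (h : EuclideanSpace ℝ (Fin d)) :
    Tendsto (fun n => 1 / 2 * ∫ z, hessianForm l θ₀ n z h h ∂μ n) atTop (𝓝 (Lbar (θ₀ + h))) := by
  have h1 := hnorm.tendsto (θ₀ + h)
  have h2 : Tendsto (fun n : ℕ => (√(n : ℝ))⁻¹ * (‖h‖ ^ 3 * (1 + K))) atTop (𝓝 0) := by
    simpa using (tendsto_inv_atTop_zero.comp
      (Real.tendsto_sqrt_atTop.comp (tendsto_natCast_atTop_atTop (R := ℝ)))).mul_const
        (‖h‖ ^ 3 * (1 + (K : ℝ)))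
  have h3 : Tendsto (fun n => ∫ ω, (empLoss l n (fun i => Z n i ω) (θ₀ + h) -
      empLoss l n (fun i => Z n i ω) θ₀) ∂P n - 1 / 2 * ∫ z, hessianForm l θ₀ n z h h ∂μ n)
      atTop (𝓝 0) := by
    refine squeeze_zero_norm' ?_ h2
    filter_upwards [eventually_gt_atTop 0, eventually_inv_sqrt_smul_mem_ball hG.pos ‖θ₀‖,
      eventually_inv_sqrt_smul_mem_ball hG.pos ‖θ₀ + h‖] with n hn hb hb'
    rw [integral_empLoss_sub hexp hn]
    exact hG.abs_integral_sub_half_hessian_le hexp.measurable_loss (hexp.integrable_loss n hn)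
      (hexp.isMinOn n hn) hn (hb _ le_rfl) h (hb' _ le_rfl)
  simpa using h1.sub h3

/-- The limit of the expected loss is exactly quadratic: it is a limit of quadratic forms, hence
homogeneous of degree two around `θ₀`, and its Hessian is the identity. -/
theorem Lbar_eq_half_norm_sq (hexp : Experiments l μ P Z θ₀ Sig)
    (hnorm : NormalizedLoss l P Z θ₀ Lbar) (hG : DerivativeEnvelope l μ ρ K G)
    (h : EuclideanSpace ℝ (Fin d)) :
    Lbar (θ₀ + h) = 1 / 2 * ‖h‖ ^ 2 := by
  have hom : ∀ t : ℝ, Lbar (θ₀ + t • h) = t ^ 2 * Lbar (θ₀ + h) := by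
    intro t
    refine tendsto_nhds_unique (tendsto_integral_hessianForm_self hexp hnorm hG (t • h)) ?_
    have := (tendsto_integral_hessianForm_self hexp hnorm hG h).const_mul (t ^ 2)
    refine this.congr fun n => ?_
    simp only [map_smul, _root_.smul_apply, smul_eq_mul, integral_const_mul]
    ring
  have hline : ∀ t : ℝ, HasDerivAt (fun t : ℝ => θ₀ + t • h) h t := fun t => by
    simpa using ((hasDerivAt_id t).smul_const h).const_add θ₀
  have hcont : Tendsto (fun t : ℝ => θ₀ + t • h) (𝓝 0) (𝓝 θ₀) := by
    have := (hline 0).continuousAt.tendsto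
    simpa using this
  have hd : ∀ᶠ t : ℝ in 𝓝 0, inner ℝ (gradient Lbar (θ₀ + t • h)) h = 2 * Lbar (θ₀ + h) * t := by
    filter_upwards [hcont.eventually hnorm.differentiable] with t ht
    have h1 := ht.hasFDerivAt.comp_hasDerivAt t (hline t)
    have h2 : HasDerivAt (fun t : ℝ => Lbar (θ₀ + t • h)) (2 * Lbar (θ₀ + h) * t) t := by
      simp only [hom]
      convert! (hasDerivAt_pow 2 t).mul_const (Lbar (θ₀ + h)) using 1
      simp; ring
    rw [inner_gradient_left]
    exact h1.unique h2
  have h3 : HasDerivAt (fun t : ℝ => inner ℝ (gradient Lbar (θ₀ + t • h)) h) (‖h‖ ^ 2) 0 := by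
    have hh : HasFDerivAt (gradient Lbar) (ContinuousLinearMap.id ℝ _)
        (θ₀ + (0 : ℝ) • h) := by
      simpa using hnorm.hessian
    have := (hh.comp_hasDerivAt 0 (hline 0)).inner ℝ (hasDerivAt_const (0 : ℝ) h)
    simpa using this
  have h4 : HasDerivAt (fun t : ℝ => 2 * Lbar (θ₀ + h) * t) (2 * Lbar (θ₀ + h)) 0 := by
    simpa using (hasDerivAt_id (0 : ℝ)).const_mul (2 * Lbar (θ₀ + h))
  have := (h3.congr_of_eventuallyEq (hd.mono fun t ht => ht.symm)).unique h4
  linarith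

theorem tendsto_integral_hessianForm (hexp : Experiments l μ P Z θ₀ Sig)
    (hnorm : NormalizedLoss l P Z θ₀ Lbar) (hG : DerivativeEnvelope l μ ρ K G)
    (v w : EuclideanSpace ℝ (Fin d)) :
    Tendsto (fun n => ∫ z, hessianForm l θ₀ n z v w ∂μ n) atTop (𝓝 (inner ℝ v w)) := by
  have hq : ∀ h, Tendsto (fun n => 1 / 2 * ∫ z, hessianForm l θ₀ n z h h ∂μ n) atTop
      (𝓝 (1 / 2 * ‖h‖ ^ 2)) := fun h => by
    rw [← Lbar_eq_half_norm_sq hexp hnorm hG]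
    exact tendsto_integral_hessianForm_self hexp hnorm hG h
  -- polarization
  have hpol := ((hq (v + w)).sub (hq v)).sub (hq w)
  have e : 1 / 2 * ‖v + w‖ ^ 2 - 1 / 2 * ‖v‖ ^ 2 - 1 / 2 * ‖w‖ ^ 2 = inner ℝ v w := by
    rw [norm_add_sq_real]; ring
  rw [e] at hpol
  refine hpol.congr' ?_
  filter_upwards [eventually_gt_atTop 0, eventually_inv_sqrt_smul_mem_ball hG.pos ‖θ₀‖]
    with n hn hb
  have hi : ∀ v w, Integrable (fun z => hessianForm l θ₀ n z v w) (μ n) := fun v w =>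
    (hG.memLp_hessianForm hexp.measurable_loss hn (hb _ le_rfl) v w).1.integrable one_le_two
  have hi' : Integrable (fun z => hessianForm l θ₀ n z (v + w) (v + w) -
      hessianForm l θ₀ n z v v) (μ n) := (hi _ _).sub (hi _ _)
  rw [← mul_sub, ← mul_sub, ← integral_sub (hi _ _) (hi _ _), ← integral_sub hi' (hi _ _),
    ← integral_const_mul]
  refine integral_congr_ae ?_
  filter_upwards [hG.taylor n hn] with z hz
  have hs : hessianForm l θ₀ n z v w = hessianForm l θ₀ n z w v := hz.hessian_symm _ v w
  simp only [map_add, _root_.add_apply]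
  rw [hs]
  ring

end Moments

/-! ### The remainder of the quadratic approximation -/

section Remainder

variable {d : ℕ} {𝒵 : Type*}

/-- The inner product as a continuous bilinear form. -/
noncomputable def innerForm (E : Type*) [NormedAddCommGroup E] [InnerProductSpace ℝ E] :
    E →L[ℝ] E →L[ℝ] ℝ :=
  (isBoundedBilinearMap_inner (𝕜 := ℝ) (E := E)).toContinuousLinearMap

theorem innerForm_apply {E : Type*} [NormedAddCommGroup E] [InnerProductSpace ℝ E] (v w : E) :
    innerForm E v w = inner ℝ v w :=
  rfl

/-- The average Hessian of the sample at `θ₀ / √n`, minus the identity. -/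
noncomputable def hessianGap (l : EuclideanSpace ℝ (Fin d) → 𝒵 → ℝ)
    (θ₀ : EuclideanSpace ℝ (Fin d)) (n : ℕ) (z : Fin n → 𝒵) :
    EuclideanSpace ℝ (Fin d) →L[ℝ] EuclideanSpace ℝ (Fin d) →L[ℝ] ℝ :=
  (n : ℝ)⁻¹ • ∑ i, hessianForm l θ₀ n (z i) - innerForm _

/-- The error of the approximation of the empirical loss by a quadratic centred at `thetaTilde`. -/
noncomputable def lossRemainder (l : EuclideanSpace ℝ (Fin d) → 𝒵 → ℝ)
    (θ₀ : EuclideanSpace ℝ (Fin d)) (n : ℕ) (z : Fin n → 𝒵) (θ : EuclideanSpace ℝ (Fin d)) : ℝ :=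
  empLoss l n z θ - empLoss l n z θ₀ - 1 / 2 * ‖θ - thetaTilde l θ₀ n z‖ ^ 2 +
    1 / 2 * ‖θ₀ - thetaTilde l θ₀ n z‖ ^ 2

variable {l : EuclideanSpace ℝ (Fin d) → 𝒵 → ℝ} {θ₀ : EuclideanSpace ℝ (Fin d)} {n : ℕ}

theorem hasFDerivAt_lossRemainder {z : Fin n → 𝒵} (h : ∀ i, Differentiable ℝ fun β => l β (z i))
    (θ : EuclideanSpace ℝ (Fin d)) :
    HasFDerivAt (lossRemainder l θ₀ n z)
      ((√(n : ℝ))⁻¹ • ∑ i, fderiv ℝ (fun β => l β (z i)) ((√(n : ℝ))⁻¹ • θ) -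
        innerForm _ (θ - thetaTilde l θ₀ n z)) θ := by
  have h1 : HasFDerivAt (empLoss l n z)
      (∑ i, (√(n : ℝ))⁻¹ • fderiv ℝ (fun β => l β (z i)) ((√(n : ℝ))⁻¹ • θ)) θ := by
    refine HasFDerivAt.fun_sum fun i _ => ?_
    have := (h i ((√(n : ℝ))⁻¹ • θ)).hasFDerivAt.comp θ
      ((hasFDerivAt_id θ).const_smul (√(n : ℝ))⁻¹)
    refine this.congr_fderiv ?_
    ext v; simp
  have h2 : HasFDerivAt (fun θ => ‖θ - thetaTilde l θ₀ n z‖ ^ 2)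
      ((2 : ℝ) • innerForm _ (θ - thetaTilde l θ₀ n z)) θ := by
    have := ((hasFDerivAt_id θ).sub_const (thetaTilde l θ₀ n z)).norm_sq
    refine this.congr_fderiv ?_
    ext v; simp [innerForm_apply]
  refine (((h1.sub_const _).sub (h2.const_mul (1 / 2))).add_const _).congr_fderiv ?_
  rw [Finset.smul_sum, smul_smul]
  norm_num

theorem differentiable_lossRemainder {z : Fin n → 𝒵}
    (h : ∀ i, Differentiable ℝ fun β => l β (z i)) : Differentiable ℝ (lossRemainder l θ₀ n z) :=
  fun θ => (hasFDerivAt_lossRemainder h θ).differentiableAt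

/-- The derivative of the remainder is the Hessian gap, applied to `θ - θ₀`, plus a Taylor
remainder that is smaller by a factor `1 / √n`. -/
theorem norm_gradient_lossRemainder_le (hn : 0 < n) {z : Fin n → 𝒵} {ρ : ℝ} {G : 𝒵 → ℝ}
    (h : ∀ i, TaylorControl (fun β => l β (z i)) ρ (G (z i)))
    (h0 : (√(n : ℝ))⁻¹ • θ₀ ∈ Metric.ball 0 ρ) {θ : EuclideanSpace ℝ (Fin d)}
    (hθ : (√(n : ℝ))⁻¹ • θ ∈ Metric.ball 0 ρ) :
    ‖gradient (lossRemainder l θ₀ n z) θ‖ ≤ ‖hessianGap l θ₀ n z‖ * ‖θ - θ₀‖ +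
      ((√(n : ℝ))⁻¹ * ((n : ℝ)⁻¹ * ∑ i, G (z i))) * ‖θ - θ₀‖ ^ 2 := by
  have hn' : (0 : ℝ) < n := by exact_mod_cast hn
  have hss : (√(n : ℝ))⁻¹ * (√(n : ℝ))⁻¹ = (n : ℝ)⁻¹ := by
    rw [← mul_inv, Real.mul_self_sqrt hn'.le]
  set s := (√(n : ℝ))⁻¹ with hs
  have hs0 : 0 ≤ s := by positivity
  rw [gradient, LinearIsometryEquiv.norm_map,
    (hasFDerivAt_lossRemainder (fun i => (h i).differentiable) θ).fderiv]
  have hinf : ∀ i, innerForm _ (influence l θ₀ n (z i)) =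
      -fderiv ℝ (fun β => l β (z i)) (s • θ₀) := by
    intro i
    ext v
    rw [innerForm_apply, influence, inner_neg_left, inner_gradient_left]
    rfl
  have htil : innerForm _ (θ - thetaTilde l θ₀ n z) = innerForm _ (θ - θ₀) +
      s • ∑ i, fderiv ℝ (fun β => l β (z i)) (s • θ₀) := by
    rw [thetaTilde, ← hs, ← sub_sub, map_sub (innerForm _) (θ - θ₀), map_smul, map_sum]
    simp only [hinf, Finset.sum_neg_distrib, smul_neg, sub_neg_eq_add]
  have hsplit : s • ∑ i, fderiv ℝ (fun β => l β (z i)) (s • θ) -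
      innerForm _ (θ - thetaTilde l θ₀ n z) = hessianGap l θ₀ n z (θ - θ₀) +
      s • ∑ i, (fderiv ℝ (fun β => l β (z i)) (s • θ) - fderiv ℝ (fun β => l β (z i)) (s • θ₀) -
        fderiv ℝ (fderiv ℝ fun β => l β (z i)) (s • θ₀) (s • θ - s • θ₀)) := by
    rw [htil, hessianGap, ← smul_sub]
    simp only [Finset.sum_sub_distrib, smul_sub, map_smul, ← Finset.smul_sum, _root_.sub_apply,
      _root_.smul_apply, _root_.sum_apply, hessianForm, ← hs, ← hss, mul_smul,
      map_sub]
    abel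
  rw [hsplit]
  refine (norm_add_le _ _).trans (add_le_add ((hessianGap l θ₀ n z).le_opNorm _) ?_)
  rw [norm_smul, Real.norm_of_nonneg hs0]
  calc _ ≤ s * ∑ i, G (z i) * ‖s • θ - s • θ₀‖ ^ 2 := by
        refine mul_le_mul_of_nonneg_left ((norm_sum_le _ _).trans ?_) hs0
        exact Finset.sum_le_sum fun i _ => (h i).norm_fderiv_sub_le h0 hθ
    _ = _ := by
        rw [← Finset.sum_mul, ← smul_sub, norm_smul, Real.norm_of_nonneg hs0, ← hss]
        ring

theorem norm_bilinear_le_sum (B : EuclideanSpace ℝ (Fin d) →L[ℝ] EuclideanSpace ℝ (Fin d) →L[ℝ] ℝ) :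
    ‖B‖ ≤ ∑ i, ∑ j, |B (EuclideanSpace.single i 1) (EuclideanSpace.single j 1)| := by
  have hsum : ∀ v : EuclideanSpace ℝ (Fin d), v = ∑ i, v i • EuclideanSpace.single i (1 : ℝ) := by
    intro v
    have := (EuclideanSpace.basisFun (Fin d) ℝ).sum_repr v
    simpa using this.symm
  refine ContinuousLinearMap.opNorm_le_bound₂ _
    (Finset.sum_nonneg fun i _ => Finset.sum_nonneg fun j _ => abs_nonneg _) fun v w => ?_
  conv_lhs => rw [hsum v, hsum w]
  simp only [map_sum, map_smul, _root_.sum_apply, _root_.smul_apply, smul_eq_mul]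
  simp only [Finset.sum_mul, Finset.mul_sum]
  refine (norm_sum_le _ _).trans ?_
  rw [Finset.sum_comm]
  refine Finset.sum_le_sum fun i _ => ?_
  refine (norm_sum_le _ _).trans ?_
  refine Finset.sum_le_sum fun j _ => ?_
  rw [norm_mul, norm_mul, Real.norm_eq_abs (B _ _)]
  calc ‖w i‖ * (‖v j‖ * |B (EuclideanSpace.single j 1) (EuclideanSpace.single i 1)|)
      ≤ ‖w‖ * (‖v‖ * |B (EuclideanSpace.single j 1) (EuclideanSpace.single i 1)|) := by
        gcongr <;> exact PiLp.norm_apply_le _ _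
    _ = _ := by ring

end Remainder

section RemainderLimits

variable {d : ℕ} {𝒵 : Type*} [MeasurableSpace 𝒵] {l : EuclideanSpace ℝ (Fin d) → 𝒵 → ℝ}
  {μ : ℕ → Measure 𝒵} [∀ n, IsProbabilityMeasure (μ n)]
  {ρ : ℝ} {K : ℝ≥0} {G : ℕ → 𝒵 → ℝ} {θ₀ : EuclideanSpace ℝ (Fin d)}
  {Ω : ℕ → Type*} [∀ n, MeasurableSpace (Ω n)] {P : ∀ n, Measure (Ω n)}
  [∀ n, IsProbabilityMeasure (P n)]
  {Z : ∀ n, Fin n → Ω n → 𝒵} {Sig : Matrix (Fin d) (Fin d) ℝ}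
  {Lbar : EuclideanSpace ℝ (Fin d) → ℝ}

theorem isLittleOP_hessianGap (hexp : Experiments l μ P Z θ₀ Sig)
    (hnorm : NormalizedLoss l P Z θ₀ Lbar) (hG : DerivativeEnvelope l μ ρ K G) :
    IsLittleOP P fun n ω => ‖hessianGap l θ₀ n fun i => Z n i ω‖ₑ := by
  have hvw : ∀ v w : EuclideanSpace ℝ (Fin d),
      IsLittleOP P fun n ω => ‖hessianGap l θ₀ n (fun i => Z n i ω) v w‖ₑ := by
    intro v w
    have h1 := isLittleOP_average_sub_integral hexp.indep hexp.law
      (ξ := fun n z => hessianForm l θ₀ n z v w) (K := (‖v‖ * ‖w‖) ^ 2 * K) (by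
        filter_upwards [eventually_gt_atTop 0, eventually_inv_sqrt_smul_mem_ball hG.pos ‖θ₀‖]
          with n hn hb
        exact hG.memLp_hessianForm hexp.measurable_loss hn (hb _ le_rfl) v w)
    have h2 : IsLittleOP P fun n _ =>
        ‖∫ z, hessianForm l θ₀ n z v w ∂μ n - inner ℝ v w‖ₑ := by
      refine IsLittleOP.of_lintegral (Eventually.of_forall fun n => aemeasurable_const) ?_
      have := (tendsto_integral_hessianForm hexp hnorm hG v w).sub_const (inner ℝ v w)
      rw [sub_self] at this
      simpa using this.enorm
    refine (h1.add h2).mono (Eventually.of_forall fun n => Eventually.of_forall fun ω => ?_)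
    refine (Eq.le ?_).trans (enorm_add_le _ _)
    congr 1
    simp [hessianGap, innerForm_apply]
  refine (IsLittleOP.sum Finset.univ fun i _ => IsLittleOP.sum Finset.univ fun j _ =>
    hvw (EuclideanSpace.single i 1) (EuclideanSpace.single j 1)).mono
    (Eventually.of_forall fun n => Eventually.of_forall fun ω => ?_)
  rw [← ofReal_norm]
  refine (ENNReal.ofReal_le_ofReal (norm_bilinear_le_sum _)).trans (Eq.le ?_)
  rw [ENNReal.ofReal_sum_of_nonneg fun i _ => Finset.sum_nonneg fun j _ => abs_nonneg _]
  refine Finset.sum_congr rfl fun i _ => ?_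
  rw [ENNReal.ofReal_sum_of_nonneg fun j _ => abs_nonneg _]
  exact Finset.sum_congr rfl fun j _ => (Real.enorm_eq_ofReal_abs _).symm

theorem isLittleOP_iSup_gradient_lossRemainder (hexp : Experiments l μ P Z θ₀ Sig)
    (hnorm : NormalizedLoss l P Z θ₀ Lbar) (hG : DerivativeEnvelope l μ ρ K G) (C : ℝ) :
    IsLittleOP P fun n ω => ⨆ (θ : EuclideanSpace ℝ (Fin d)) (_ : ‖θ‖ ≤ C),
      ‖gradient (lossRemainder l θ₀ n fun i => Z n i ω) θ‖ₑ := by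
  set D : ℝ≥0 := (C + ‖θ₀‖).toNNReal with hD
  have hav := isLittleOP_scaled_average (P := P) hexp.law (G := G) (K := K)
    fun n hn => ⟨hG.aemeasurable n hn, hG.moment n hn⟩
  refine (((isLittleOP_hessianGap hexp hnorm hG).const_mul D).add
    (hav.const_mul (D ^ 2))).mono ?_
  filter_upwards [eventually_gt_atTop 0, eventually_inv_sqrt_smul_mem_ball hG.pos ‖θ₀‖,
    eventually_inv_sqrt_smul_mem_ball hG.pos C] with n hn hb hb'
  filter_upwards [ae_taylorControl hexp hG hn] with ω hω
  refine iSup₂_le fun θ hθ => ?_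
  have hle : ‖θ - θ₀‖ ≤ D :=
    (norm_sub_le _ _).trans ((add_le_add_left hθ _).trans (Real.le_coe_toNNReal _))
  have h1 := norm_gradient_lossRemainder_le hn hω (hb _ le_rfl) (hb' θ hθ)
  set a := hessianGap l θ₀ n fun i => Z n i ω
  set b := (√(n : ℝ))⁻¹ * ((n : ℝ)⁻¹ * ∑ i, G n (Z n i ω))
  have h2 : ‖gradient (lossRemainder l θ₀ n fun i => Z n i ω) θ‖ ≤ D * ‖a‖ + D ^ 2 * |b| := by
    refine h1.trans (add_le_add ?_ ?_)
    · rw [mul_comm]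
      exact mul_le_mul_of_nonneg_right hle (norm_nonneg _)
    · rw [mul_comm]
      exact mul_le_mul (pow_le_pow_left₀ (norm_nonneg _) hle 2) (le_abs_self _)
        (by
          have hnn : ∀ i, 0 ≤ G n (Z n i ω) := fun i =>
            (norm_nonneg _).trans ((hω i).norm_fderiv_le _ (hb _ le_rfl))
          have := Finset.sum_nonneg fun i (_ : i ∈ Finset.univ) => hnn i
          positivity) (by positivity)
  rw [← ofReal_norm]
  refine (ENNReal.ofReal_le_ofReal h2).trans (Eq.le ?_)
  rw [ENNReal.ofReal_add (by positivity) (by positivity), ENNReal.ofReal_mul (by positivity),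
    ENNReal.ofReal_mul (by positivity), ofReal_norm, Real.enorm_eq_ofReal_abs,
    ENNReal.ofReal_pow (by positivity), ENNReal.ofReal_coe_nnreal, ENNReal.coe_pow]

/-- The remainder vanishes at `θ₀`, so a bound for its gradient on a ball containing `θ₀` bounds the
remainder itself. -/
theorem isLittleOP_iSup_lossRemainder (hexp : Experiments l μ P Z θ₀ Sig)
    (hnorm : NormalizedLoss l P Z θ₀ Lbar) (hG : DerivativeEnvelope l μ ρ K G) (C : ℝ) :
    IsLittleOP P fun n ω => ⨆ (θ : EuclideanSpace ℝ (Fin d)) (_ : ‖θ‖ ≤ C),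
      ‖lossRemainder l θ₀ n (fun i => Z n i ω) θ‖ₑ := by
  set C' := max C ‖θ₀‖ with hC'
  -- a positive constant, so that the product below is infinite when the supremum is
  set D : ℝ≥0 := ⟨C' + ‖θ₀‖ + 1, by positivity⟩ with hD
  refine ((isLittleOP_iSup_gradient_lossRemainder hexp hnorm hG C').const_mul D).mono ?_
  filter_upwards [eventually_gt_atTop 0] with n hn
  filter_upwards [ae_taylorControl hexp hG hn] with ω hω
  refine iSup₂_le fun θ hθ => ?_
  set ε := lossRemainder l θ₀ n fun i => Z n i ω with hε
  set S := ⨆ (θ : EuclideanSpace ℝ (Fin d)) (_ : ‖θ‖ ≤ C'), ‖gradient ε θ‖ₑ with hS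
  have hD0 : (D : ℝ≥0∞) ≠ 0 := by
    have : 0 < D := by
      rw [← NNReal.coe_pos, hD]
      show 0 < C' + ‖θ₀‖ + 1
      positivity
    exact_mod_cast this.ne'
  by_cases hStop : S = ⊤
  · rw [hStop, ENNReal.mul_top hD0]; exact le_top
  have hgrad : ∀ x ∈ Metric.closedBall (0 : EuclideanSpace ℝ (Fin d)) C',
      ‖fderiv ℝ ε x‖ ≤ S.toReal := by
    intro x hx
    have hx' : ‖x‖ ≤ C' := by simpa using hx
    have h1 : ‖gradient ε x‖ₑ ≤ S :=
      le_iSup₂ (f := fun (θ : EuclideanSpace ℝ (Fin d)) (_ : ‖θ‖ ≤ C') => ‖gradient ε θ‖ₑ) x hx'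
    have h2 := ENNReal.toReal_mono hStop h1
    rwa [toReal_enorm, gradient, LinearIsometryEquiv.norm_map] at h2
  have hmvt := (convex_closedBall _ C').norm_image_sub_le_of_norm_fderiv_le (𝕜 := ℝ)
    (fun x _ => differentiable_lossRemainder (fun i => (hω i).differentiable) x) hgrad
    (mem_closedBall_zero_iff.2 (le_max_right C ‖θ₀‖))
    (mem_closedBall_zero_iff.2 (hθ.trans (le_max_left C ‖θ₀‖)))
  have hε0 : ε θ₀ = 0 := by simp [hε, lossRemainder]
  rw [← hε, hε0, sub_zero] at hmvt
  have hle : ‖θ - θ₀‖ ≤ D :=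
    (norm_sub_le _ _).trans (by
      show ‖θ‖ + ‖θ₀‖ ≤ C' + ‖θ₀‖ + 1
      linarith [le_max_left C ‖θ₀‖])
  rw [← ofReal_norm, ← ENNReal.ofReal_toReal hStop, ← ENNReal.ofReal_coe_nnreal,
    ← ENNReal.ofReal_mul D.coe_nonneg, mul_comm]
  exact ENNReal.ofReal_le_ofReal
    (hmvt.trans (mul_le_mul_of_nonneg_left hle ENNReal.toReal_nonneg))

/-- `thetaTilde` is `θ₀` plus a normalized sum of centred influence functions. -/
theorem isBigOP_thetaTilde (hexp : Experiments l μ P Z θ₀ Sig)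
    (hG : DerivativeEnvelope l μ ρ K G) :
    IsBigOP P fun n ω => ‖thetaTilde l θ₀ n fun i => Z n i ω‖ₑ := by
  have hcoord : ∀ j : Fin d, IsBigOP P fun n ω => ‖(√(n : ℝ))⁻¹ * ∑ i,
      scoreForm l θ₀ n (Z n i ω) (EuclideanSpace.single j 1)‖ₑ := fun j =>
    isBigOP_normalized_sum hexp.indep hexp.law
      (ξ := fun n z => scoreForm l θ₀ n z (EuclideanSpace.single j 1))
      (K := ‖EuclideanSpace.single j (1 : ℝ)‖ ^ 2 * K) (by
        filter_upwards [eventually_gt_atTop 0, eventually_inv_sqrt_smul_mem_ball hG.pos ‖θ₀‖]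
          with n hn hb
        have h := hG.memLp_scoreForm hexp.measurable_loss hn (hb _ le_rfl)
          (EuclideanSpace.single j 1)
        exact ⟨h.1, h.2, hG.integral_scoreForm_eq_zero hexp.measurable_loss
          (hexp.integrable_loss n hn) (hexp.isMinOn n hn) hn (hb _ le_rfl) _⟩)
  refine ((IsBigOP.const ‖θ₀‖₊).add (IsBigOP.sum Finset.univ fun j _ => hcoord j)).mono
    (Eventually.of_forall fun n => Eventually.of_forall fun ω => ?_)
  refine (enorm_add_le _ _).trans (add_le_add (le_of_eq rfl) ?_)
  set u := (√(n : ℝ))⁻¹ • ∑ i, influence l θ₀ n (Z n i ω) with hu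
  have hsum : u = ∑ j, u j • EuclideanSpace.single j (1 : ℝ) := by
    have := (EuclideanSpace.basisFun (Fin d) ℝ).sum_repr u
    simpa using this.symm
  rw [hsum]
  refine (enorm_sum_le _ _).trans (Finset.sum_le_sum fun j _ => ?_)
  have hj : u j = -((√(n : ℝ))⁻¹ * ∑ i,
      scoreForm l θ₀ n (Z n i ω) (EuclideanSpace.single j 1)) := by
    have h1 : u j = inner ℝ u (EuclideanSpace.single j (1 : ℝ)) := by
      simp [EuclideanSpace.inner_single_right]
    rw [h1, hu, real_inner_smul_left, sum_inner]
    simp only [influence, inner_neg_left, inner_gradient_left, Finset.sum_neg_distrib, mul_neg]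
    rfl
  rw [enorm_smul, hj, enorm_neg]
  simp [← ofReal_norm]

end RemainderLimits

/-! ### Estimators -/

section Estimators

variable {d : ℕ} {Ω : ℕ → Type*} [∀ n, MeasurableSpace (Ω n)] {P : ∀ n, Measure (Ω n)}

/-- Minimizers of convex random functions that are approximated by random quadratics, uniformly over
a family of convex penalties with minimum at `0`. -/
theorem isLittleOP_iSup_sub_of_isArgmin {ι : Type*} {L ε : ∀ n, Ω n → EuclideanSpace ℝ (Fin d) → ℝ}
    {x : ∀ n, Ω n → EuclideanSpace ℝ (Fin d)} {c : ∀ n, Ω n → ℝ}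
    {ψ : ι → EuclideanSpace ℝ (Fin d) → ℝ} {q g : ι → ∀ n, Ω n → EuclideanSpace ℝ (Fin d)}
    (hψ : ∀ i, ConvexOn ℝ Set.univ (ψ i)) (hψ0 : ∀ i, IsMinOn (ψ i) Set.univ 0)
    (hL : WithProbApproachingOne P fun n => {ω | ConvexOn ℝ Set.univ (L n ω)})
    (hLε : ∀ n ω θ, L n ω θ = c n ω + 1 / 2 * ‖θ - x n ω‖ ^ 2 + ε n ω θ)
    (hε : ∀ C : ℝ, IsLittleOP P fun n ω =>
      ⨆ (θ : EuclideanSpace ℝ (Fin d)) (_ : ‖θ‖ ≤ C), ‖ε n ω θ‖ₑ)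
    (hx : IsBigOP P fun n ω => ‖x n ω‖ₑ)
    (hg : ∀ i n ω, IsMinOn (fun g => 1 / 2 * ‖g‖ ^ 2 + ψ i (x n ω + g)) Set.univ (g i n ω))
    (hq : ∀ i n ω, IsArgmin (fun θ => L n ω θ + ψ i θ) (q i n ω)) :
    IsLittleOP P fun n ω => ⨆ i, ‖q i n ω - x n ω - g i n ω‖ₑ := by
  intro δ hδ
  obtain ⟨δ', hδ'0, hδ'⟩ := ENNReal.lt_iff_exists_nnreal_btwn.1 hδ
  have hδ'pos : 0 < (δ' : ℝ) := by exact_mod_cast hδ'0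
  rw [ENNReal.tendsto_nhds_zero]
  intro η hη
  have hη3 : 0 < η / 3 := ENNReal.div_pos hη.ne' (by simp)
  obtain ⟨K, hK⟩ := hx (η / 3) hη3
  -- any `τ` with `4 * τ < δ' ^ 2` does
  set τ : ℝ≥0 := δ' ^ 2 / 8 with hτ
  have hτ0 : 0 < τ := by
    have : 0 < δ' := by exact_mod_cast hδ'0
    positivity
  filter_upwards [hK, ENNReal.tendsto_nhds_zero.1 hL _ hη3,
    ENNReal.tendsto_nhds_zero.1 (hε (2 * K + δ') τ (by exact_mod_cast hτ0)) _ hη3]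
    with n h1 h2 h3
  refine (measure_mono (t := ({ω | (K : ℝ≥0∞) < ‖x n ω‖ₑ} ∪ {ω | ConvexOn ℝ Set.univ (L n ω)}ᶜ) ∪
    {ω | (τ : ℝ≥0∞) ≤ ⨆ (θ : EuclideanSpace ℝ (Fin d)) (_ : ‖θ‖ ≤ 2 * K + δ'), ‖ε n ω θ‖ₑ})
    fun ω hω => ?_).trans ?_
  · by_contra hcon
    simp only [Set.mem_union, Set.mem_compl_iff, Set.mem_ofPred_eq, not_or, not_lt, not_not,
      not_le] at hcon hω
    obtain ⟨⟨hxK, hconv⟩, hετ⟩ := hcon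
    have hxK' : ‖x n ω‖ ≤ K := by
      rw [enorm_le_coe] at hxK; exact_mod_cast hxK
    have hετ' : ∀ θ, ‖θ‖ ≤ 2 * K + δ' → |ε n ω θ| ≤ τ := by
      intro θ hθ
      have h4 : ‖ε n ω θ‖ₑ ≤ τ := (le_iSup₂ (f := fun (θ : EuclideanSpace ℝ (Fin d))
        (_ : ‖θ‖ ≤ 2 * K + δ') => ‖ε n ω θ‖ₑ) θ hθ).trans hετ.le
      rw [enorm_le_coe, ← NNReal.coe_le_coe, coe_nnnorm] at h4
      exact h4
    have hall : (⨆ i, ‖q i n ω - x n ω - g i n ω‖ₑ) ≤ δ' := by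
      refine iSup_le fun i => ?_
      have := norm_sub_sub_le_of_isArgmin hconv (hψ i) (hψ0 i) (hLε n ω) hετ' hδ'pos
        (by rw [hτ]; push_cast; nlinarith [pow_pos hδ'pos 2]) (by linarith) (hg i n ω) (hq i n ω)
      rw [enorm_le_coe, ← NNReal.coe_le_coe, coe_nnnorm]
      exact this
    exact absurd (hω.trans hall) (not_le.2 hδ')
  · calc _ ≤ η / 3 + η / 3 + η / 3 := (measure_union_le _ _).trans
          (add_le_add ((measure_union_le _ _).trans (add_le_add h1 h2)) h3)
      _ = η := ENNReal.add_thirds η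

end Estimators

theorem mainTheorem8 {d : ℕ} {𝒵 : Type*} [MeasurableSpace 𝒵]
    {Ω : ℕ → Type*} [∀ n, MeasurableSpace (Ω n)]
    (l : EuclideanSpace ℝ (Fin d) → 𝒵 → ℝ)
    (μ : ℕ → Measure 𝒵) [∀ n, IsProbabilityMeasure (μ n)]
    (P : ∀ n, Measure (Ω n)) [∀ n, IsProbabilityMeasure (P n)]
    (Z : ∀ n, Fin n → Ω n → 𝒵)
    (θ₀ : EuclideanSpace ℝ (Fin d)) (Sig : Matrix (Fin d) (Fin d) ℝ)
    (Lbar : EuclideanSpace ℝ (Fin d) → ℝ)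
    -- the penalty, the set of tuning parameters, and the (penalized) ERM estimators
    (pen : EuclideanSpace ℝ (Fin d) → ℝ) (Λ : Set ℝ)
    (θhat : ∀ n, Ω n → EuclideanSpace ℝ (Fin d))
    (θhatPen : ∀ n, ℝ → Ω n → EuclideanSpace ℝ (Fin d))
    (hpen_convex : ConvexOn ℝ Set.univ pen)
    (hpen_min : IsMinOn pen Set.univ 0)
    (hΛ : ∀ lam ∈ Λ, 0 ≤ lam)
    (hθhat : ∀ n ω, IsArgmin (empLoss l n fun i => Z n i ω) (θhat n ω))
    (hθhatPen : ∀ n, ∀ lam ∈ Λ, ∀ ω,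
      IsArgmin (fun θ => empLoss l n (fun i => Z n i ω) θ + lam * pen θ) (θhatPen n lam ω))
    -- the standing assumptions
    (hexp : Experiments l μ P Z θ₀ Sig)
    (hnorm : NormalizedLoss l P Z θ₀ Lbar)
    (hlip : LipschitzLoss l μ)
    (hbdd : IsBigOP P fun n ω => ‖θhat n ω‖ₑ)
    (hconv : StronglyConvexLoss l P Z)
    (hscore : ScoreConditions l μ θ₀)
    (hhess : HessianConditions l μ P Z θ₀)
    (hfourth : FourthDerivativeConditions l μ) :
    -- the quadratic approximation of the empirical loss
    (∃ ε : ∀ n, Ω n → EuclideanSpace ℝ (Fin d) → ℝ,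
      (∀ n ω θ, empLoss l n (fun i => Z n i ω) θ - empLoss l n (fun i => Z n i ω) θ₀ =
        1 / 2 * ‖θ - thetaTilde l θ₀ n (fun i => Z n i ω)‖ ^ 2
          - 1 / 2 * ‖θ₀ - thetaTilde l θ₀ n (fun i => Z n i ω)‖ ^ 2 + ε n ω θ) ∧
      (∀ n : ℕ, 0 < n → ∀ᵐ ω ∂P n, Differentiable ℝ (ε n ω)) ∧
      (∀ C : ℝ, IsLittleOP P fun n ω =>
        ⨆ (θ : EuclideanSpace ℝ (Fin d)) (_ : ‖θ‖ ≤ C), ‖ε n ω θ‖ₑ) ∧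
      (∀ C : ℝ, IsLittleOP P fun n ω =>
        ⨆ (θ : EuclideanSpace ℝ (Fin d)) (_ : ‖θ‖ ≤ C), ‖gradient (ε n ω) θ‖ₑ)) ∧
    -- the approximation of the ERM estimator
    (IsLittleOP P fun n ω => ‖θhat n ω - thetaTilde l θ₀ n (fun i => Z n i ω)‖ₑ) ∧
    -- the approximation of the penalized ERM estimators, uniformly in the tuning parameter
    (IsLittleOP P fun n ω => ⨆ lam ∈ Λ,
      ‖θhatPen n lam ω - thetaTilde l θ₀ n (fun i => Z n i ω)
        - gShrink pen lam (thetaTilde l θ₀ n (fun i => Z n i ω))‖ₑ) := by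
  obtain ⟨ρ, hρ, K, hK⟩ := exists_taylorControl hexp.measurable_loss hlip hfourth
  choose! G hGm hGK hGt using hK
  have hG : DerivativeEnvelope l μ ρ K G := ⟨hρ, hGm, hGK, hGt⟩
  have hε := isLittleOP_iSup_lossRemainder hexp hnorm hG
  have hx := isBigOP_thetaTilde hexp hG
  have hL : WithProbApproachingOne P fun n =>
      {ω | ConvexOn ℝ Set.univ (empLoss l n fun i => Z n i ω)} := by
    obtain ⟨κ, hκ, hsc⟩ := hconv
    refine tendsto_of_tendsto_of_tendsto_of_le_of_le tendsto_const_nhds hsc (fun _ => zero_le)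
      fun n => measure_mono (Set.compl_subset_compl.2 fun ω hω => ?_)
    have hω' : StrongConvexOn Set.univ κ (empLoss l n fun i => Z n i ω) := hω
    exact UniformConvexOn.convexOn hω' fun r => by
      show 0 ≤ κ / 2 * r ^ 2
      positivity
  have hLε : ∀ n ω θ, empLoss l n (fun i => Z n i ω) θ =
      (empLoss l n (fun i => Z n i ω) θ₀ -
        1 / 2 * ‖θ₀ - thetaTilde l θ₀ n (fun i => Z n i ω)‖ ^ 2) +
      1 / 2 * ‖θ - thetaTilde l θ₀ n (fun i => Z n i ω)‖ ^ 2 +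
      lossRemainder l θ₀ n (fun i => Z n i ω) θ := fun n ω θ => by
    rw [lossRemainder]; ring
  refine ⟨⟨fun n ω => lossRemainder l θ₀ n fun i => Z n i ω, fun n ω θ => ?_, fun n hn => ?_, hε,
    isLittleOP_iSup_gradient_lossRemainder hexp hnorm hG⟩, ?_, ?_⟩
  · simp only [lossRemainder]; ring
  · filter_upwards [ae_taylorControl hexp hG hn] with ω hω
    exact differentiable_lossRemainder fun i => (hω i).differentiable
  · -- the unpenalized estimator is the case of a vanishing penalty
    have h := isLittleOP_iSup_sub_of_isArgmin (ι := Unit) (ψ := fun _ _ => 0)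
      (q := fun _ => θhat) (g := fun _ _ _ => 0) (fun _ => convexOn_const 0 convex_univ)
      (fun _ => isMinOn_const) hL hLε hε hx
      (fun _ n ω g _ => by
        show 1 / 2 * ‖(0 : EuclideanSpace ℝ (Fin d))‖ ^ 2 + 0 ≤ 1 / 2 * ‖g‖ ^ 2 + 0
        simp)
      (fun _ n ω => by simpa using hθhat n ω)
    simpa using h
  · have hψ : ∀ lam : Λ, ConvexOn ℝ Set.univ fun θ => lam.1 * pen θ := fun lam =>
      hpen_convex.smul (hΛ lam lam.2)
    have hψ0 : ∀ lam : Λ, IsMinOn (fun θ => lam.1 * pen θ) Set.univ 0 := fun lam θ _ =>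
      mul_le_mul_of_nonneg_left (hpen_min (Set.mem_univ θ)) (hΛ lam lam.2)
    have h := isLittleOP_iSup_sub_of_isArgmin (ι := Λ) (ψ := fun lam θ => lam.1 * pen θ)
      (q := fun lam n ω => θhatPen n lam.1 ω)
      (g := fun lam n ω => gShrink pen lam.1 (thetaTilde l θ₀ n fun i => Z n i ω))
      hψ hψ0 hL hLε hε hx
      (fun lam n ω => isMinOn_argmin (exists_isMinOn_half_norm_sq_add (hψ lam) (hψ0 lam) _))
      (fun lam n ω => hθhatPen n lam.1 lam.2 ω)
    simpa only [iSup_subtype'] using h
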